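/- \textbf{Notation.} $S_\infty$ is the group of permutations of $\{1,2,3,\dots\}$ moving finitely many points, $S_p\subset S_\infty$, and $t_{ij}$ is the transposition of $i,j$. For $w\in S_p$ and $v\in S_\infty$, $w\times v\in S_\infty$ is given by $(w\times v)(i)=w(i)$ for $i\le p$ and $(w\times v)(p+i)=p+v(i)$; $1^n$ is the identity of $S_n$. The code of $w$ is $c(w)=(c_1,c_2,\dots)$ with $c_i=\#\{j>i: w(j)<w(i)\}$; $\ell(c(w))=\max\{i: c_i\ne0\}$ ($0$ if $w$ is the identity), and $\ell(w)=\sum_i c_i$. The diagram $D(w)$ has a box in row $i$ and column $w(k)$ for each $i<k$ with $w(k)<w(i)$. A permutation is Grassmannian if it has at most one descent. The Schubert polynomial is $\mathfrak S_w=\sum x_{i_1}\cdots x_{i_\ell}$, summed over all reduced words $a_1\cdots a_\ell$ of $w$ and all $i_1\le\dots\le i_\ell$ with $i_j\le a_j$, and $i_j<i_{j+1}$ whenever $a_j<a_{j+1}$; the Stanley symmetric function is the coefficientwise limit $F_w=\lim_{n\to\infty}\mathfrak S_{1^n\times w}$. \textbf{Canonical expansion.} Given $w,u$, write $\mathfrak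 S_{1^i\times w}\,\mathfrak S_{1^i\times u}=\sum_{v\in S_\infty}c_i(v)\,\mathfrak S_v$ for $i\ge0$. Let $V_0=\{v: c_0(v)\ne0\}$ and, for $i\ge1$, let $V_i$ be the set of $v$ with $c_i(v)\neq0$ that are not of the form $1\times v'$ with $c_{i-1}(v')\ne0$. For $v\in V_i$ put $c_{wu}^v=c_i(v)$. With $k=\ell(w)+\ell(u)$, the canonical expansion of $F_wF_u$ is $\sum_{i=0}^{k}\sum_{v\in V_i}c_{wu}^vF_v$. \textbf{MT-moves.} Let $x\in S_\infty$ have a descent, let $r$ be its largest descent and $s$ the largest integer with $x(s)<x(r)$. An MT-move replaces $x$ (and $D(x)$) by $y=xt_{rs}t_{jr}$ (and $D(y)$) for some $j<r$ with $\ell(y)=\ell(x)$. \textbf{Statement.} Let $w\in S_p$ and $u\in S_q$ with $\ell(c(w))=\ell(c(u))=m$ and $u$ Grassmannian. Apply MT-moves successively, in all possible ways, to $D(1^m\times w\times u)$, stopping at a diagram as soon as all its boxes lie in the first $2m$ rows (or if no MT-move is possible), and let $A$ be the multiset of final diagrams, one for each complete sequence of moves. Then $F_wF_u=\sum_{i=0}^{k}\sum_{v\in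 V_i}c_{wu}^vF_v$, and for all $0\le i\le k$ and $v\in V_i$ one has $i\le m$ and $$c_{wu}^v=\#\{D\in A\mid D=D(1^{m-i}\times v)\},$$ this number being finite. Moreover every $D\in A$ equals $D(1^{m-i}\times v)$ for some $0\le i\le\min(k,m)$ and $v\in V_i$. -/

import Mathlib

/-! Conventions.  Rows, columns, positions, values and variable indices are numbered from `0`:
position (row, variable, ...) `i` here is position `i + 1` in the usual one-based notation. -/

/-- The group `S_∞` of permutations of `ℕ` that move only finitely many points. -/
def SInf : Subgroup (Equiv.Perm ℕ) where
  carrier := {w | {i | w i ≠ i}.Finite}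
  one_mem' := by simp
  mul_mem' := by
    intro a b ha hb
    refine (Set.Finite.union ha hb).subset ?_
    intro i hi
    by_contra h
    simp only [Set.mem_union, Set.mem_ofPred_eq, not_or, not_not] at h
    apply hi
    rw [Equiv.Perm.mul_apply, h.2, h.1]
  inv_mem' := by
    intro a ha
    refine Set.Finite.subset ha ?_
    intro i hi h
    apply hi
    rw [Equiv.Perm.inv_eq_iff_eq]
    exact h.symm

namespace SInf

/-- The permutation `w × v`: `w` acts on `0, …, p - 1`, and `v`, shifted by `p`, on the rest. -/
def directSum {p : ℕ} (w : Equiv.Perm (Fin p)) (v : SInf) : SInf :=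
  ⟨(finSumNatEquiv p).permCongr (Equiv.sumCongr w v.1), by
    have hv : {i | v.1 i ≠ i}.Finite := v.2
    refine ((Set.finite_lt_nat p).union (hv.image (fun i => p + i))).subset ?_
    intro i hi
    by_cases h : i < p
    · exact Or.inl h
    · right
      have h' : p ≤ i := Nat.le_of_not_lt h
      refine ⟨i - p, ?_, Nat.add_sub_cancel' h'⟩
      intro hfix
      apply hi
      rw [Equiv.permCongr_apply, finSumNatEquiv_symm_apply_of_ge h', Equiv.sumCongr_apply,
        Sum.map_inr, hfix, finSumNatEquiv_apply_right, Nat.add_sub_cancel' h']⟩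

/-- The inclusion of `S_p` in `S_∞`. -/
def ofFin {p : ℕ} (w : Equiv.Perm (Fin p)) : SInf := directSum w 1

/-- The permutation `1ⁿ × v`. -/
def ones (n : ℕ) (v : SInf) : SInf := directSum (1 : Equiv.Perm (Fin n)) v

/-- The transposition of `i` and `j`. -/
def transp (i j : ℕ) : SInf :=
  ⟨Equiv.swap i j, by
    refine (Set.toFinite ({i, j} : Set ℕ)).subset ?_
    intro k hk
    by_contra h
    simp only [Set.mem_insert_iff, Set.mem_singleton_iff, not_or] at h
    exact hk (Equiv.swap_apply_of_ne_of_ne h.1 h.2)⟩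

/-- The entry `c_i` of the code of `w`. -/
noncomputable def code (w : SInf) (i : ℕ) : ℕ := {j | i < j ∧ w.1 j < w.1 i}.ncard

/-- The length `ℓ(c(w))` of the code: the last (one-based) position of a nonzero entry, and `0`
if there is none. -/
noncomputable def codeLength (w : SInf) : ℕ := sSup {k | ∃ i, k = i + 1 ∧ code w i ≠ 0}

/-- The length `ℓ(w)`: the number of inversions. -/
noncomputable def length (w : SInf) : ℕ :=
  {x : ℕ × ℕ | x.1 < x.2 ∧ w.1 x.2 < w.1 x.1}.ncard

/-- The descents of `w`. -/
def descents (w : SInf) : Set ℕ := {i | w.1 (i + 1) < w.1 i}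

/-- A permutation is Grassmannian if it has at most one descent. -/
def IsGrassmannian (w : SInf) : Prop := (descents w).Subsingleton

/-- The diagram `D(w)`: the box in row `i` and column `w k` for every inversion `i < k`,
`w k < w i`. -/
def diagram (w : SInf) : Set (ℕ × ℕ) :=
  {b | ∃ k, b.1 < k ∧ w.1 k < w.1 b.1 ∧ b.2 = w.1 k}

/-! ### Schubert polynomials and Stanley symmetric functions -/

/-- `a` is a reduced word of `w`; the letter `k` stands for the transposition of `k`, `k + 1`. -/
def IsReducedWord (w : SInf) (a : List ℕ) : Prop :=
  (a.map fun k => transp k (k + 1)).prod = w ∧ a.length = length w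

/-- Lists `(a_1, i_1), …, (a_p, i_p)` such that `a` is a reduced word of `w` and `i` is an
`a`-compatible sequence.  For each `w` there are finitely many of them. -/
def compatibleWords (w : SInf) : Set (List (ℕ × ℕ)) :=
  {l | IsReducedWord w (l.map Prod.fst) ∧
    l.IsChain (fun x y => x.2 ≤ y.2) ∧
    (∀ x ∈ l, x.2 ≤ x.1) ∧
    l.IsChain (fun x y => x.1 < y.1 → x.2 < y.2)}

/-- The Schubert polynomial of `w`, the sum of `x_{i_1} ⋯ x_{i_p}` over all reduced words of `w`
and all sequences compatible with them. -/
noncomputable def schubert (w : SInf) : MvPolynomial ℕ ℤ :=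
  ∑ᶠ l ∈ compatibleWords w, (l.map fun x => MvPolynomial.X x.2).prod

/-- The Stanley symmetric function of `w`, the coefficientwise limit of the Schubert polynomials
of `1ⁿ × w`. -/
noncomputable def stanley (w : SInf) : MvPowerSeries ℕ ℤ := fun d =>
  Filter.limUnder Filter.atTop fun n : ℕ => MvPolynomial.coeff d (schubert (ones n w))

/-- `c` is the family of coefficients of an expansion of `f` into Schubert polynomials. -/
def IsSchubertExpansion (f : MvPolynomial ℕ ℤ) (c : SInf →₀ ℤ) : Prop :=
  f = c.sum fun v a => a • schubert v

/-- The coefficients of the expansion of `f` into Schubert polynomials (the Schubert polynomials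
are a `ℤ`-basis, so that the expansion exists and is unique). -/
noncomputable def schubertExpansion (f : MvPolynomial ℕ ℤ) : SInf →₀ ℤ :=
  Classical.epsilon (IsSchubertExpansion f)

/-- The coefficients of the expansion of the product of the Schubert polynomials of `1ⁱ × w` and
`1ⁱ × u` into Schubert polynomials. -/
noncomputable def prodCoeff (w u : SInf) (i : ℕ) : SInf →₀ ℤ :=
  schubertExpansion (schubert (ones i w) * schubert (ones i u))

open Classical in
/-- The set `V_i` of the permutations that are new in the expansion for `1ⁱ × w`, `1ⁱ × u`,
compared to the one for `i - 1`: those not of the form `1 × v` with `v` in the latter. -/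
noncomputable def newTerms (w u : SInf) : ℕ → Finset SInf
  | 0 => (prodCoeff w u 0).support
  | i + 1 => (prodCoeff w u (i + 1)).support.filter
      fun v => ∀ v' ∈ (prodCoeff w u i).support, v ≠ ones 1 v'

/-- The index set `V = V_0 ∪ ⋯ ∪ V_k`, `k = ℓ(w) + ℓ(u)`, of the canonical expansion of
`F_w F_u`; every `v ∈ V_i` is recorded together with `i`.  The term of `⟨i, v⟩` in the canonical
expansion is `prodCoeff w u i v • stanley v`. -/
noncomputable def canonicalTerms (w u : SInf) : Finset (Σ _ : ℕ, SInf) :=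
  (Finset.range (length w + length u + 1)).sigma (newTerms w u)

/-! ### Maximal transitions -/

/-- An MT-move from `x` to `y`: with `r` the largest descent of `x` and `s` the largest position
with `x s < x r`, `y = x t_{rs} t_{jr}` for some `j < r`, and `y` has the same length as `x`. -/
def IsMTMove (x y : SInf) : Prop :=
  ∃ r s j, IsGreatest (descents x) r ∧ IsGreatest {s | x.1 s < x.1 r} s ∧ j < r ∧
    y = x * transp r s * transp j r ∧ length y = length x

/-- All boxes of the diagram of `x` lie in the first `N` rows. -/
def BoxesInFirstRows (N : ℕ) (x : SInf) : Prop := ∀ b ∈ diagram x, b.1 < N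

/-- `l` is a complete run, from `x` to `y`, of successive MT-moves: no move is applied to a
permutation whose diagram lies in the first `N` rows, and the run ends only there or where no
move is possible. -/
structure IsMTRun (N : ℕ) (x y : SInf) (l : List SInf) : Prop where
  head : l.head? = some x
  last : l.getLast? = some y
  chain : l.IsChain fun a b => ¬ BoxesInFirstRows N a ∧ IsMTMove a b
  final : BoxesInFirstRows N y ∨ ∀ z, ¬ IsMTMove y z

/-- The complete runs from `x` that end with the diagram `D`.  The multiset of the diagrams
obtained from `D(x)` contains `D` once for each of them. -/
def mtRunsTo (N : ℕ) (x : SInf) (D : Set (ℕ × ℕ)) : Set (List SInf) :=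
  {l | ∃ y, IsMTRun N x y l ∧ diagram y = D}

end SInf

/-!
The generating function of compatible words is a product of factors `1 + t u_j` in the nilCoxeter
algebra, and the Yang–Baxter equation for these factors gives the divided differences
`𝔖_w - s_i 𝔖_w = (x_i - x_{i+1}) 𝔖_{w s_i}` at the descents `i` of `w`, the left-hand side being
`0` at the other `i`.  Divided differences determine a polynomial up to a constant, so that they
yield the linear independence of the Schubert polynomials, the factorization
`𝔖_{w × v} = 𝔖_w 𝔖_{1^p × v}` and Monk's formula.  By the latter, the span of the Schubert
polynomials is an ideal, hence it contains every polynomial.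

Monk's formula at the largest descent `r` of `x` gives the maximal transition
`𝔖_x = x_r 𝔖_{x t_{rs}} + ∑ 𝔖_y`, the sum being over the MT-moves from `x` to `y`.  Setting
`x_N = x_{N+1} = ⋯ = 0` kills the first term as long as `r ≥ N`, so that `𝔖_x` becomes the sum
of the Schubert polynomials of the ends of the runs of MT-moves, provided that a run never gets
stuck.  It does not if `x` fixes at least as many initial points as it has nonempty rows from row
`N` on, a condition that MT-moves preserve.  For `x = 1^m × w × u` and `N = 2m`, what remains of
`𝔖_x` is `𝔖_{1^m × w} 𝔖_{1^m × u}`, since `𝔖_{1^n × u}` is symmetric in its first variables.  The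
expansions of these products for consecutive `m` are related by setting `x_0 = 0`.
-/

/-- The defining relations of the nilCoxeter algebra of type `A`, for a family of elements
of a ring. -/
structure NilCoxeter {E : Type*} [Ring E] (u : ℕ → E) : Prop where
  sq : ∀ i, u i * u i = 0
  comm : ∀ i j, i + 1 < j → u i * u j = u j * u i
  braid : ∀ i, u i * u (i + 1) * u i = u (i + 1) * u i * u (i + 1)

namespace NilCoxeter

variable {R E : Type*} [CommRing R] [Ring E] [Algebra R E]

/-- The product `(1 + t u_a) (1 + t u_{a+1}) ⋯ (1 + t u_{a+k-1})`, denoted `A_a(t)` by Fomin and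
Stanley when `a + k` is the number of generators. -/
def rowProd (u : ℕ → E) (t : R) (a k : ℕ) : E :=
  ((List.range' a k).map fun j => 1 + t • u j).prod

/-- The product `A_{k-1}(y_{k-1}) ⋯ A_1(y_1) A_0(y_0)`, where `A_i(t)` involves the generators
`u_i, …, u_{n-1}`. -/
def rowsProd (u : ℕ → E) (n : ℕ) (y : ℕ → R) : ℕ → E
  | 0 => 1
  | k + 1 => rowProd u (y k) k (n - k) * rowsProd u n y k

section

variable (u : ℕ → E)

theorem rowProd_succ (t : R) (a k : ℕ) :
    rowProd u t a (k + 1) = (1 + t • u a) * rowProd u t (a + 1) k := rfl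

theorem rowProd_zero_left (a k : ℕ) : rowProd u (0 : R) a k = 1 := by
  simp [rowProd]

theorem rowsProd_zero_left (n k : ℕ) : rowsProd u n (fun _ => (0 : R)) k = 1 := by
  induction k with
  | zero => rfl
  | succ k ih => rw [rowsProd, ih, rowProd_zero_left, one_mul]

theorem rowsProd_congr (n : ℕ) {y z : ℕ → R} {k : ℕ} (h : ∀ i < k, y i = z i) :
    rowsProd u n y k = rowsProd u n z k := by
  induction k with
  | zero => rfl
  | succ k ih => rw [rowsProd, rowsProd, ih fun i hi => h i (by omega), h k (by omega)]

end

variable {u : ℕ → E}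

theorem one_sub_mul_one_add (hu : NilCoxeter u) (t : R) (i : ℕ) :
    (1 - t • u i) * (1 + t • u i) = 1 := by
  simp only [sub_mul, mul_add, one_mul, mul_one, smul_mul_smul_comm, hu.sq, smul_zero]
  abel

theorem commute_rowProd (hu : NilCoxeter u) (t : R) {i a : ℕ} (h : i + 1 < a) (k : ℕ) :
    Commute (u i) (rowProd u t a k) := by
  refine Commute.list_prod_right _ _ fun x hx => ?_
  obtain ⟨j, hj, rfl⟩ := List.mem_map.1 hx
  have hij : i + 1 < j := h.trans_le (List.mem_range'_1.1 hj).1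
  exact (Commute.one_right _).add_right (Commute.smul_right (hu.comm i j hij) t)

/-- A form of the Yang–Baxter equation: the left-hand side is symmetric in `x` and `y`. -/
theorem yangBaxter_eq (hu : NilCoxeter u) (x y : R) (i : ℕ) :
    (1 + y • u i) * (1 + y • u (i + 1)) * (1 + x • u i) * (1 - y • u (i + 1)) =
      1 + (x + y) • u i + (x * y) • (u (i + 1) * u i - u i * u (i + 1)) := by
  have ha := hu.sq i
  have hb := hu.sq (i + 1)
  have hab := hu.braid i
  generalize u i = a at *
  generalize u (i + 1) = b at *
  have haba : a * (b * a) = b * a * b := by rw [← mul_assoc, hab]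
  have habab : a * (b * a * b) = 0 := by
    rw [← mul_assoc, ← mul_assoc, hab, mul_assoc, hb, mul_zero]
  have haab : a * (a * b) = 0 := by rw [← mul_assoc, ha, zero_mul]
  have last_three : (1 + y • b) * (1 + x • a) * (1 - y • b) =
      1 + x • a + (x * y) • (b * a - a * b) - (x * y * y) • (b * a * b) := by
    simp only [mul_add, add_mul, mul_sub, one_mul, mul_one, smul_mul_assoc, mul_smul_comm, hb,
      smul_zero, smul_sub]
    module
  rw [mul_assoc, mul_assoc, ← mul_assoc (1 + y • b), last_three]
  simp only [mul_add, add_mul, mul_sub, one_mul, mul_one, smul_mul_assoc, mul_smul_comm, ha, haba,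
    habab, haab, smul_zero, smul_sub, smul_add]
  module

theorem rowProd_mul_rowProd_add_two (hu : NilCoxeter u) (x y : R) (a k : ℕ) :
    rowProd u x a (k + 2) * rowProd u y a (k + 2) =
      (1 + x • u a) * (1 + x • u (a + 1)) * (1 + y • u a) * (1 - x • u (a + 1)) *
        (rowProd u x (a + 1) (k + 1) * rowProd u y (a + 1) (k + 1)) := by
  have hcomm : rowProd u x (a + 2) k * (1 + y • u a) = (1 + y • u a) * rowProd u x (a + 2) k :=
    ((Commute.one_left _).add_left
      ((hu.commute_rowProd x (Nat.lt_succ_self _) k).smul_left y)).symm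
  have hinv : rowProd u x (a + 2) k = (1 - x • u (a + 1)) * rowProd u x (a + 1) (k + 1) := by
    rw [rowProd_succ, ← mul_assoc, hu.one_sub_mul_one_add, one_mul]
  calc rowProd u x a (k + 2) * rowProd u y a (k + 2)
      = (1 + x • u a) * (1 + x • u (a + 1)) * (rowProd u x (a + 2) k * (1 + y • u a)) *
          rowProd u y (a + 1) (k + 1) := by
        simp only [rowProd_succ, mul_assoc]
    _ = _ := by
        rw [hcomm, hinv]
        simp only [mul_assoc]

theorem commute_rowProd_rowProd (hu : NilCoxeter u) (x y : R) (a k : ℕ) :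
    Commute (rowProd u x a k) (rowProd u y a k) := by
  induction k generalizing a with
  | zero => exact Commute.one_left _
  | succ k ih =>
    cases k with
    | zero =>
      have hself : Commute (x • u a) (y • u a) := ((Commute.refl _).smul_left x).smul_right y
      simpa [rowProd] using (Commute.one_left _).add_left ((Commute.one_right _).add_right hself)
    | succ k =>
      rw [commute_iff_eq, hu.rowProd_mul_rowProd_add_two, hu.rowProd_mul_rowProd_add_two,
        hu.yangBaxter_eq, hu.yangBaxter_eq, (ih (a + 1)).eq, add_comm x, mul_comm x]

theorem rowProd_mul_rowProd_succ (hu : NilCoxeter u) (s t : R) (a k : ℕ) :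
    rowProd u s (a + 1) k * rowProd u t a (k + 1) =
      (1 - s • u a) * (rowProd u s a (k + 1) * rowProd u t a (k + 1)) := by
  rw [rowProd_succ u s, ← mul_assoc, ← mul_assoc, hu.one_sub_mul_one_add, one_mul]

/-- Exchanging `y_i` and `y_{i+1}` affects only two adjacent rows, whose product is
`(1 - y_{i+1} u_i)` times an expression that is symmetric in `y_i` and `y_{i+1}`. -/
theorem rowsProd_sub_swap (hu : NilCoxeter u) (y : ℕ → R) {n i k : ℕ} (hik : i + 2 ≤ k)
    (hkn : k ≤ n) :
    rowsProd u n y k - rowsProd u n (fun j => y (Equiv.swap i (i + 1) j)) k =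
      (y i - y (i + 1)) • (u i * rowsProd u n y k) := by
  induction k, hik using Nat.le_induction with
  | base =>
    have hlow : rowsProd u n (fun j => y (Equiv.swap i (i + 1) j)) i = rowsProd u n y i :=
      rowsProd_congr u n fun j hj => by rw [Equiv.swap_apply_of_ne_of_ne] <;> omega
    have hni : n - i = n - (i + 1) + 1 := by omega
    simp only [rowsProd, Equiv.swap_apply_left, Equiv.swap_apply_right, hlow]
    rw [← mul_assoc, ← mul_assoc, hni, hu.rowProd_mul_rowProd_succ, hu.rowProd_mul_rowProd_succ,
      (hu.commute_rowProd_rowProd (y i) (y (i + 1)) i _).eq]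
    generalize rowProd u (y (i + 1)) i _ * rowProd u (y i) i _ = Z
    generalize rowsProd u n y i = P
    have hmul : u i * ((1 - y (i + 1) • u i) * Z * P) = u i * (Z * P) := by
      rw [mul_assoc, ← mul_assoc (u i), mul_sub, mul_smul_comm, hu.sq, smul_zero, sub_zero,
        mul_one]
    rw [hmul]
    simp only [sub_mul, one_mul, smul_mul_assoc, mul_assoc]
    module
  | succ k hk ih =>
    rw [rowsProd, rowsProd, Equiv.swap_apply_of_ne_of_ne (by omega) (by omega), ← mul_sub,
      ih (by omega), ← mul_assoc (u i), (hu.commute_rowProd (y k) (by omega) _).eq, mul_smul_comm,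
      mul_assoc]

end NilCoxeter

namespace SInf

@[ext] theorem ext {x y : SInf} (h : ∀ i, x.1 i = y.1 i) : x = y :=
  Subtype.ext (Equiv.ext h)

@[simp] theorem mul_apply (x y : SInf) (i : ℕ) : (x * y).1 i = x.1 (y.1 i) := rfl

@[simp] theorem one_apply (i : ℕ) : (1 : SInf).1 i = i := rfl

theorem apply_inj (x : SInf) {i j : ℕ} : x.1 i = x.1 j ↔ i = j := x.1.injective.eq_iff

theorem apply_ne (x : SInf) {i j : ℕ} (h : i ≠ j) : x.1 i ≠ x.1 j := x.1.injective.ne h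

theorem transp_apply (i j k : ℕ) :
    (transp i j).1 k = if k = i then j else if k = j then i else k :=
  Equiv.swap_apply_def i j k

@[simp] theorem mul_transp_cancel (x : SInf) (i j : ℕ) : x * transp i j * transp i j = x := by
  have hself : transp i j * transp i j = 1 := Subtype.ext (Equiv.swap_mul_self i j)
  rw [mul_assoc, hself, mul_one]

theorem mul_transp_eq_iff {x y : SInf} {i j : ℕ} : x * transp i j = y ↔ x = y * transp i j := by
  constructor <;> rintro rfl <;> rw [mul_transp_cancel]

@[simp] theorem mul_transp_apply_left (x : SInf) (a b : ℕ) : (x * transp a b).1 a = x.1 b :=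
  congrArg x.1 (Equiv.swap_apply_left a b)

@[simp] theorem mul_transp_apply_right (x : SInf) (a b : ℕ) : (x * transp a b).1 b = x.1 a :=
  congrArg x.1 (Equiv.swap_apply_right a b)

theorem mul_transp_apply_of_ne (x : SInf) {a b k : ℕ} (ha : k ≠ a) (hb : k ≠ b) :
    (x * transp a b).1 k = x.1 k := by
  rw [mul_apply, transp_apply, if_neg ha, if_neg hb]

theorem mul_transp_eq_transp_mul (w : SInf) (a b : ℕ) :
    w * transp a b = transp (w.1 a) (w.1 b) * w :=
  Subtype.ext (Equiv.mul_swap_eq_swap_mul w.1 a b)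

theorem mul_transp_mul_transp (w : SInf) (a b i j : ℕ) :
    w * transp a b * transp i j =
      w * transp i j * transp (Equiv.swap i j a) (Equiv.swap i j b) := by
  have hswap (k : ℕ) : (transp i j).1 (Equiv.swap i j k) = k := Equiv.swap_apply_self i j k
  rw [mul_assoc, mul_assoc, mul_transp_eq_transp_mul (transp i j), hswap, hswap]

/-- `w` fixes every point `i ≥ n`; in other words, `w` lies in `S_n`. -/
def FixesFrom (n : ℕ) (w : SInf) : Prop := ∀ i, n ≤ i → w.1 i = i

/-- `w` has no descent at a position `i ≥ n`. -/
def AscendsFrom (n : ℕ) (w : SInf) : Prop := ∀ i, n ≤ i → w.1 i < w.1 (i + 1)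

/-- `w` is increasing on `0, …, n - 1`, that is, it has no descent at a position `i < n - 1`. -/
def AscendsBelow (n : ℕ) (w : SInf) : Prop := ∀ i, i + 1 < n → w.1 i < w.1 (i + 1)

/-- `w` fixes every point `i < n`; in other words, `w` is of the form `1ⁿ × v`. -/
def FixesBelow (n : ℕ) (w : SInf) : Prop := ∀ i, i < n → w.1 i = i

theorem FixesFrom.mono {w : SInf} {m n : ℕ} (h : FixesFrom m w) (hmn : m ≤ n) : FixesFrom n w :=
  fun i hi => h i (hmn.trans hi)

theorem exists_fixesFrom_ge (w : SInf) (m : ℕ) : ∃ n, m ≤ n ∧ FixesFrom n w := by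
  obtain ⟨n, hn⟩ := (w.2 : {i | w.1 i ≠ i}.Finite).bddAbove
  refine ⟨max m (n + 1), le_max_left _ _, fun i hi => not_not.1 fun h => ?_⟩
  have := hn h
  omega

theorem FixesFrom.apply_lt {w : SInf} {n i : ℕ} (h : FixesFrom n w) (hi : i < n) : w.1 i < n := by
  by_contra hn
  have := (apply_inj w).1 (h _ (not_lt.1 hn))
  omega

theorem FixesFrom.inversion_lt {w : SInf} {n i k : ℕ} (h : FixesFrom n w) (hik : i < k)
    (hw : w.1 k < w.1 i) : k < n := by
  by_contra hk
  have hwk := h k (not_lt.1 hk)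
  rcases lt_or_ge i n with hi | hi
  · have := h.apply_lt hi
    omega
  · have := h i hi
    omega

theorem FixesFrom.mul_transp {w : SInf} {n a b : ℕ} (h : FixesFrom n w) (ha : a < n) (hb : b < n) :
    FixesFrom n (w * transp a b) := fun i hi => by
  rw [mul_transp_apply_of_ne _ (by omega) (by omega), h i hi]

theorem FixesBelow.le_apply {w : SInf} {n i : ℕ} (h : FixesBelow n w) (hi : n ≤ i) :
    n ≤ w.1 i := by
  by_contra hn
  have := (apply_inj w).1 (h _ (not_le.1 hn))
  omega

theorem FixesBelow.mul_transp {w : SInf} {n a b : ℕ} (h : FixesBelow n w) (ha : n ≤ a)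
    (hb : n ≤ b) : FixesBelow n (w * transp a b) := fun i hi => by
  rw [mul_transp_apply_of_ne _ (by omega) (by omega), h i hi]

theorem AscendsFrom.strictMonoOn {w : SInf} {n : ℕ} (h : AscendsFrom n w) :
    StrictMonoOn w.1 (Set.Ici n) := by
  intro i hi k _ hik
  have hi : n ≤ i := hi
  induction k, Nat.succ_le_of_lt hik using Nat.le_induction with
  | base => exact h i hi
  | succ k hk ih =>
    have hnk : n ≤ k := by omega
    exact (ih hnk hk).trans (h k hnk)

theorem lt_or_gt_succ (w : SInf) (i : ℕ) : w.1 i < w.1 (i + 1) ∨ w.1 (i + 1) < w.1 i :=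
  lt_or_gt_of_ne (apply_ne w (Nat.succ_ne_self i).symm)

theorem eq_one_of_ascendsFrom_zero {w : SInf} (h : AscendsFrom 0 w) : w = 1 := by
  have hmono : StrictMono w.1 := strictMono_nat_of_lt_succ fun i => h i i.zero_le
  have hrefl : hmono.orderIsoOfSurjective w.1 w.1.surjective = OrderIso.refl ℕ :=
    OrderIso.subsingleton_of_wellFoundedLT.elim _ _
  ext i
  exact congrArg (fun e : ℕ ≃o ℕ => e i) hrefl

theorem exists_descent {w : SInf} (h : w ≠ 1) : ∃ i, w.1 (i + 1) < w.1 i := by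
  by_contra! hw
  exact h (eq_one_of_ascendsFrom_zero fun i _ => (lt_or_gt_succ w i).resolve_right (hw i).not_gt)

/-! ### Length, covers and reduced words -/

/-- The set of inversions, whose cardinality is `length w`. -/
def inversions (w : SInf) : Set (ℕ × ℕ) := {x | x.1 < x.2 ∧ w.1 x.2 < w.1 x.1}

theorem length_eq_ncard_inversions (w : SInf) : length w = (inversions w).ncard := rfl

theorem finite_inversions (w : SInf) : (inversions w).Finite := by
  obtain ⟨n, -, hn⟩ := exists_fixesFrom_ge w 0
  refine ((Set.finite_lt_nat n).prod (Set.finite_lt_nat n)).subset ?_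
  rintro ⟨i, k⟩ ⟨hik, hw⟩
  have hk : k < n := hn.inversion_lt hik hw
  exact ⟨hik.trans hk, hk⟩

theorem inversions_mul_transp_adj {w : SInf} {i : ℕ} (h : w.1 i < w.1 (i + 1)) :
    inversions (w * transp i (i + 1)) = insert (i, i + 1)
      (Prod.map (Equiv.swap i (i + 1)) (Equiv.swap i (i + 1)) '' inversions w) := by
  ext ⟨a, b⟩
  simp only [inversions, Set.mem_insert_iff, Set.mem_image, Set.mem_ofPred_eq, mul_apply,
    Prod.exists, Prod.map_apply, Prod.mk.injEq, transp]
  constructor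
  · rintro ⟨hab, hw⟩
    refine or_iff_not_imp_left.2 fun hne => ⟨_, _, ⟨?_, hw⟩, Equiv.swap_apply_self _ _ _,
      Equiv.swap_apply_self _ _ _⟩
    simp only [Equiv.swap_apply_def]
    split_ifs <;> omega
  · rintro (⟨rfl, rfl⟩ | ⟨c, d, ⟨hcd, hw⟩, rfl, rfl⟩)
    · simpa using h
    · have hne : ¬ (c = i ∧ d = i + 1) := by
        rintro ⟨rfl, rfl⟩
        omega
      simp only [Equiv.swap_apply_self]
      refine ⟨?_, hw⟩
      simp only [Equiv.swap_apply_def]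
      split_ifs <;> omega

theorem length_mul_transp_adj_of_lt {w : SInf} {i : ℕ} (h : w.1 i < w.1 (i + 1)) :
    length (w * transp i (i + 1)) = length w + 1 := by
  have hnotMem : (i, i + 1) ∉
      Prod.map (Equiv.swap i (i + 1)) (Equiv.swap i (i + 1)) '' inversions w := by
    rintro ⟨⟨c, d⟩, ⟨hcd, -⟩, heq⟩
    simp only [Prod.map_apply, Prod.mk.injEq, Equiv.swap_apply_eq_iff, Equiv.swap_apply_left,
      Equiv.swap_apply_right] at heq
    simp only at hcd
    omega
  rw [length_eq_ncard_inversions, inversions_mul_transp_adj h,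
    Set.ncard_insert_of_notMem hnotMem ((finite_inversions w).image _),
    Set.ncard_image_of_injective _ ((Equiv.injective _).prodMap (Equiv.injective _)),
    length_eq_ncard_inversions]

theorem length_mul_transp_adj_of_gt {w : SInf} {i : ℕ} (h : w.1 (i + 1) < w.1 i) :
    length (w * transp i (i + 1)) + 1 = length w := by
  have hlt : (w * transp i (i + 1)).1 i < (w * transp i (i + 1)).1 (i + 1) := by
    rwa [mul_transp_apply_left, mul_transp_apply_right]
  rw [← length_mul_transp_adj_of_lt hlt, mul_transp_cancel]

theorem length_mul_transp_adj_le (w : SInf) (i : ℕ) :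
    length (w * transp i (i + 1)) ≤ length w + 1 := by
  rcases lt_or_gt_succ w i with h | h
  · exact (length_mul_transp_adj_of_lt h).le
  · have := length_mul_transp_adj_of_gt h
    omega

theorem length_one : length 1 = 0 := by
  rw [length_eq_ncard_inversions, Set.ncard_eq_zero (finite_inversions _)]
  exact Set.eq_empty_of_forall_notMem fun x hx => lt_asymm hx.1 hx.2

theorem length_eq_zero {w : SInf} : length w = 0 ↔ w = 1 := by
  refine ⟨fun h => not_not.1 fun hw => ?_, fun h => h ▸ length_one⟩
  obtain ⟨i, hi⟩ := exists_descent hw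
  have := length_mul_transp_adj_of_gt hi
  omega

theorem card_filter_Ioo_succ {a i : ℕ} (hai : a < i) (P : ℕ → Prop) [DecidablePred P] :
    ((Finset.Ioo a (i + 1)).filter P).card =
      ((Finset.Ioo a i).filter P).card + if P i then 1 else 0 := by
  have hIoo : Finset.Ioo a (i + 1) = insert i (Finset.Ioo a i) := by ext; simp; omega
  rw [hIoo, Finset.filter_insert]
  split_ifs
  · exact Finset.card_insert_of_notMem (by simp)
  · rfl

/-- By induction on `b`, since `t_{a,b+1} = t_{b,b+1} t_{ab} t_{b,b+1}`. -/
theorem length_mul_transp (x : SInf) {a b : ℕ} (hab : a < b) (h : x.1 a < x.1 b) :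
    length (x * transp a b) = length x + 1 +
      2 * ((Finset.Ioo a b).filter fun c => x.1 a < x.1 c ∧ x.1 c < x.1 b).card := by
  induction b, hab using Nat.le_induction generalizing x with
  | base => simp [length_mul_transp_adj_of_lt h]
  | succ i hi ih =>
    set y := x * transp i (i + 1) with hy
    have hya : y.1 a = x.1 a := mul_transp_apply_of_ne _ (by omega) (by omega)
    have hyi : y.1 i = x.1 (i + 1) := mul_transp_apply_left _ _ _
    have hyc : ∀ c ∈ Finset.Ioo a i, y.1 c = x.1 c := fun c hc => by
      rw [Finset.mem_Ioo] at hc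
      exact mul_transp_apply_of_ne _ (by omega) (by omega)
    have hconj : x * transp a (i + 1) = y * transp a i * transp i (i + 1) := by
      rw [mul_transp_mul_transp, hy, mul_transp_cancel, Equiv.swap_apply_left,
        Equiv.swap_apply_of_ne_of_ne (by omega) (by omega)]
    have hzi : (y * transp a i).1 i = x.1 a := by rw [mul_transp_apply_right, hya]
    have hzi' : (y * transp a i).1 (i + 1) = x.1 i := by
      rw [mul_transp_apply_of_ne _ (by omega) (by omega), hy, mul_transp_apply_right]
    have hlen := ih y (by rwa [hya, hyi])
    rw [hya, hyi, Finset.filter_congr (q := fun c => x.1 a < x.1 c ∧ x.1 c < x.1 (i + 1))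
      fun c hc => by rw [hyc c hc]] at hlen
    have hlast : length (y * transp a i * transp i (i + 1)) + (if x.1 a < x.1 i then 0 else 1) =
        length (y * transp a i) + if x.1 a < x.1 i then 1 else 0 := by
      split_ifs with hai
      · rw [length_mul_transp_adj_of_lt (by rwa [hzi, hzi'])]
      · have := apply_ne x (show a ≠ i by omega)
        rw [← length_mul_transp_adj_of_gt (w := y * transp a i) (i := i) (by omega)]
    rw [hconj, card_filter_Ioo_succ hi]
    rcases lt_or_gt_succ x i with hxi | hxi
    · have hleny : length y = length x + 1 := length_mul_transp_adj_of_lt hxi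
      split_ifs at hlast ⊢ <;> omega
    · have hleny : length y + 1 = length x := length_mul_transp_adj_of_gt hxi
      split_ifs at hlast ⊢ <;> omega

/-- `x t_{ab}` covers `x` in the Bruhat order, for `a < b`. -/
def IsCover (x : SInf) (a b : ℕ) : Prop :=
  a < b ∧ x.1 a < x.1 b ∧ ∀ c, a < c → c < b → x.1 c < x.1 a ∨ x.1 b < x.1 c

theorem IsCover.length_eq {x : SInf} {a b : ℕ} (h : IsCover x a b) :
    length (x * transp a b) = length x + 1 := by
  obtain ⟨hab, hx, hbetween⟩ := h
  rw [length_mul_transp x hab hx, Finset.filter_false_of_mem, Finset.card_empty]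
  intro c hc
  have := hbetween c (Finset.mem_Ioo.1 hc).1 (Finset.mem_Ioo.1 hc).2
  omega

theorem isCover_of_length_eq {x : SInf} {a b : ℕ} (hab : a < b)
    (h : length (x * transp a b) = length x + 1) : IsCover x a b := by
  rcases lt_or_gt_of_ne (apply_ne x hab.ne) with hx | hx
  · rw [length_mul_transp x hab hx, Nat.add_eq_left, mul_eq_zero_iff_left two_ne_zero,
      Finset.card_eq_zero, Finset.filter_eq_empty_iff] at h
    refine ⟨hab, hx, fun c hac hcb => ?_⟩
    have := h (Finset.mem_Ioo.2 ⟨hac, hcb⟩)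
    have := apply_ne x hac.ne
    have := apply_ne x hcb.ne
    omega
  · have := length_mul_transp (x * transp a b) hab
      (by rwa [mul_transp_apply_left, mul_transp_apply_right])
    rw [mul_transp_cancel] at this
    omega

theorem length_prod_word_le (a : List ℕ) :
    length (a.map fun k => transp k (k + 1)).prod ≤ a.length := by
  induction a using List.reverseRecOn with
  | nil => exact length_one.le
  | append_singleton a k ih =>
    simp only [List.map_append, List.map_cons, List.map_nil, List.prod_append, List.prod_singleton,
      List.length_append, List.length_singleton]
    exact (length_mul_transp_adj_le _ _).trans (Nat.succ_le_succ ih)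

theorem isReducedWord_nil {w : SInf} : IsReducedWord w [] ↔ w = 1 :=
  ⟨fun h => h.1.symm, fun h => h ▸ ⟨rfl, length_one.symm⟩⟩

theorem isReducedWord_append_singleton {w : SInf} {a : List ℕ} {k : ℕ} :
    IsReducedWord w (a ++ [k]) ↔
      w.1 (k + 1) < w.1 k ∧ IsReducedWord (w * transp k (k + 1)) a := by
  simp only [IsReducedWord, List.map_append, List.map_cons, List.map_nil, List.prod_append,
    List.prod_singleton, List.length_append, List.length_singleton]
  rw [mul_transp_eq_iff]
  have hle := length_prod_word_le a
  constructor
  · rintro ⟨hprod, hlen⟩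
    rw [hprod] at hle
    rcases lt_or_gt_succ w k with h | h
    · have := length_mul_transp_adj_of_lt h
      omega
    · have := length_mul_transp_adj_of_gt h
      exact ⟨h, hprod, by omega⟩
  · rintro ⟨h, hprod, hlen⟩
    have := length_mul_transp_adj_of_gt h
    exact ⟨hprod, by omega⟩

theorem IsReducedWord.letter_lt {w : SInf} {a : List ℕ} (h : IsReducedWord w a) {n : ℕ}
    (hn : FixesFrom n w) : ∀ k ∈ a, k + 1 < n := by
  induction a using List.reverseRecOn generalizing w with
  | nil => simp
  | append_singleton a k ih =>
    obtain ⟨hdesc, ha⟩ := isReducedWord_append_singleton.1 h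
    have hk : k + 1 < n := hn.inversion_lt (Nat.lt_succ_self k) hdesc
    intro l hl
    rcases List.mem_append.1 hl with hl | hl
    · exact ih ha (hn.mul_transp (by omega) hk) l hl
    · rwa [List.mem_singleton.1 hl]

theorem IsReducedWord.isChain_ne {w : SInf} {a : List ℕ} (h : IsReducedWord w a) :
    a.IsChain (· ≠ ·) := by
  induction a using List.reverseRecOn generalizing w with
  | nil => exact List.IsChain.nil
  | append_singleton a k ih =>
    obtain ⟨hdesc, ha⟩ := isReducedWord_append_singleton.1 h
    refine List.isChain_append.2 ⟨ih ha, List.IsChain.singleton k, ?_⟩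
    rintro l hl _ ⟨⟩ rfl
    rw [← List.dropLast_append_getLast? l hl, isReducedWord_append_singleton,
      mul_transp_apply_left, mul_transp_apply_right] at ha
    exact hdesc.asymm ha.1

/-! ### Schubert polynomials in the nilCoxeter algebra -/

section NilCoxeterAction

open NilCoxeter MvPolynomial

/-- Right multiplication by the generator `u_i` of the nilCoxeter algebra, whose elements are
encoded by their families of coefficients with respect to the basis indexed by `S_∞`. -/
noncomputable def nilOp (R : Type*) [CommRing R] (i : ℕ) : Module.End R (SInf → R) where
  toFun f w := if w.1 (i + 1) < w.1 i then f (w * transp i (i + 1)) else 0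
  map_add' f g := by
    ext w
    simp only [Pi.add_apply]
    split_ifs <;> simp
  map_smul' c f := by
    ext w
    simp only [Pi.smul_apply, RingHom.id_apply]
    split_ifs <;> simp

open Classical in
/-- The unit of the nilCoxeter algebra. -/
noncomputable def unitCoeff (R : Type*) [CommRing R] : SInf → R := Pi.single 1 1

variable {R S : Type*} [CommRing R] [CommRing S]

theorem nilOp_apply (i : ℕ) (f : SInf → R) (w : SInf) :
    nilOp R i f w = if w.1 (i + 1) < w.1 i then f (w * transp i (i + 1)) else 0 := rfl

theorem nilOp_mul_self (i : ℕ) : nilOp R i * nilOp R i = 0 := by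
  ext f w
  simp only [Module.End.mul_apply, nilOp_apply, mul_transp_apply_left, mul_transp_apply_right,
    LinearMap.zero_apply, Pi.zero_apply]
  split_ifs <;> first | rfl | omega

theorem nilOp_mul_comm {i j : ℕ} (h : i + 1 < j) :
    nilOp R i * nilOp R j = nilOp R j * nilOp R i := by
  ext f w
  have htransp : w * transp i (i + 1) * transp j (j + 1) =
      w * transp j (j + 1) * transp i (i + 1) := by
    rw [mul_transp_mul_transp, Equiv.swap_apply_of_ne_of_ne (by omega) (by omega),
      Equiv.swap_apply_of_ne_of_ne (by omega) (by omega)]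
  simp only [Module.End.mul_apply, nilOp_apply, htransp,
    mul_transp_apply_of_ne w (show i ≠ j by omega) (show i ≠ j + 1 by omega),
    mul_transp_apply_of_ne w (show i + 1 ≠ j by omega) (show i + 1 ≠ j + 1 by omega),
    mul_transp_apply_of_ne w (show j ≠ i by omega) (show j ≠ i + 1 by omega),
    mul_transp_apply_of_ne w (show j + 1 ≠ i by omega) (show j + 1 ≠ i + 1 by omega)]
  split_ifs <;> rfl

theorem nilOp_braid (i : ℕ) : nilOp R i * nilOp R (i + 1) * nilOp R i =
    nilOp R (i + 1) * nilOp R i * nilOp R (i + 1) := by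
  ext f w
  have htransp : w * transp i (i + 1) * transp (i + 1) (i + 2) * transp i (i + 1) =
      w * transp (i + 1) (i + 2) * transp i (i + 1) * transp (i + 1) (i + 2) := by
    ext k
    simp only [mul_apply, transp_apply]
    grind
  simp only [Module.End.mul_apply, nilOp_apply, htransp, mul_apply, transp_apply]
  grind

theorem nilCoxeter_nilOp : NilCoxeter (nilOp R) :=
  ⟨nilOp_mul_self, fun _ _ => nilOp_mul_comm, nilOp_braid⟩

open Classical in
theorem prod_reverse_nilOp_apply (a : List ℕ) (w : SInf) :
    (a.map (nilOp R)).reverse.prod (unitCoeff R) w = if IsReducedWord w a then 1 else 0 := by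
  induction a using List.reverseRecOn generalizing w with
  | nil => simp [isReducedWord_nil, unitCoeff, Pi.single_apply]
  | append_singleton a k ih =>
    rw [List.map_append, List.reverse_append, List.prod_append, Module.End.mul_apply,
      isReducedWord_append_singleton]
    refine (nilOp_apply ..).trans ?_
    rw [ih, ← ite_and]
    congr

theorem prod_reverse_one_add_smul {α E : Type*} [Ring E] [Algebra R E] (c : α → R) (v : α → E)
    (L : List α) : (L.map fun x => 1 + c x • v x).reverse.prod =
      (L.sublists'.map fun l => (l.map c).prod • (l.map v).reverse.prod).sum := by
  induction L with
  | nil => simp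
  | cons b L ih =>
    simp only [List.map_cons, List.reverse_cons, List.prod_append, List.prod_singleton, ih,
      List.sublists'_cons, List.map_append, List.sum_append, mul_add, mul_one, List.map_map]
    rw [← List.sum_map_mul_right]
    congr 2
    refine List.map_congr_left fun l _ => ?_
    simp only [Function.comp_apply, List.map_cons, List.prod_cons, List.reverse_cons,
      List.prod_append, List.prod_nil, smul_mul_smul_comm, mul_comm, mul_one]

/-- The order in which the pairs (letter, variable index) occur in a compatible word: the indices
are weakly increasing, and the letters that share an index are decreasing. -/
def CompatibleOrder (x y : ℕ × ℕ) : Prop := x.2 < y.2 ∨ x.2 = y.2 ∧ y.1 < x.1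

instance : Std.Antisymm CompatibleOrder := ⟨fun a b hab hba => by
  unfold CompatibleOrder at hab hba
  omega⟩

instance : IsTrans (ℕ × ℕ) CompatibleOrder := ⟨fun a b c hab hbc => by
  unfold CompatibleOrder at *
  omega⟩

/-- The pairs `(n - 1, i), …, (i, i)`. -/
def rowList (n i : ℕ) : List (ℕ × ℕ) := ((List.range' i (n - i)).map fun a => (a, i)).reverse

/-- The pairs `(a, i)` with `i < k` and `i ≤ a < n`, listed along `CompatibleOrder`. -/
def rowsList (n k : ℕ) : List (ℕ × ℕ) := (List.range k).flatMap (rowList n)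

theorem mem_rowsList {n k : ℕ} {x : ℕ × ℕ} :
    x ∈ rowsList n k ↔ x.2 < k ∧ x.2 ≤ x.1 ∧ x.1 < n := by
  simp only [rowsList, rowList, List.mem_flatMap, List.mem_range, List.mem_reverse, List.mem_map,
    List.mem_range'_1, Prod.ext_iff]
  constructor
  · rintro ⟨i, hi, a, ha, rfl, rfl⟩
    omega
  · rintro ⟨hk, hle, hlt⟩
    exact ⟨x.2, hk, x.1, by omega, rfl, rfl⟩

theorem pairwise_rowsList (n k : ℕ) : (rowsList n k).Pairwise CompatibleOrder := by
  refine List.pairwise_flatMap.2 ⟨fun i _ => ?_, List.pairwise_lt_range.imp fun hij x hx y hy => ?_⟩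
  · rw [rowList, List.pairwise_reverse, List.pairwise_map]
    exact (List.pairwise_lt_range' ..).imp fun hab => Or.inr ⟨rfl, hab⟩
  · simp only [rowList, List.mem_reverse, List.mem_map] at hx hy
    obtain ⟨-, -, rfl⟩ := hx
    obtain ⟨-, -, rfl⟩ := hy
    exact Or.inl hij

theorem ne_of_compatibleOrder {x y : ℕ × ℕ} (h : CompatibleOrder x y) : x ≠ y := by
  rintro rfl
  unfold CompatibleOrder at h
  omega

theorem sublist_rowsList {n : ℕ} {l : List (ℕ × ℕ)} : l.Sublist (rowsList n n) ↔
    l.Pairwise CompatibleOrder ∧ ∀ x ∈ l, x.2 ≤ x.1 ∧ x.1 < n := by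
  constructor
  · exact fun h =>
      ⟨(pairwise_rowsList n n).sublist h, fun x hx => (mem_rowsList.1 (h.subset hx)).2⟩
  · rintro ⟨hpairwise, hmem⟩
    refine List.sublist_of_subperm_of_pairwise (List.subperm_of_subset
      (hpairwise.imp ne_of_compatibleOrder) fun x hx => ?_) hpairwise (pairwise_rowsList n n)
    have := hmem x hx
    exact mem_rowsList.2 (by omega)

theorem rowsProd_eq_prod_reverse {E : Type*} [Ring E] [Algebra R E] (u : ℕ → E) (n : ℕ)
    (y : ℕ → R) (k : ℕ) :
    rowsProd u n y k = ((rowsList n k).map fun x => 1 + y x.2 • u x.1).reverse.prod := by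
  induction k with
  | zero => rfl
  | succ k ih =>
    have hrow : rowProd u (y k) k (n - k) =
        ((rowList n k).map fun x => 1 + y x.2 • u x.1).reverse.prod := by
      simp only [rowProd, rowList, List.map_reverse, List.reverse_reverse, List.map_map]
      rfl
    rw [rowsProd, hrow, ih, rowsList, rowsList, List.range_succ, List.flatMap_append,
      List.map_append, List.reverse_append, List.prod_append, List.flatMap_singleton]

open Classical in
theorem rowsProd_nilOp_apply (y : ℕ → R) (n : ℕ) (w : SInf) :
    rowsProd (nilOp R) n y n (unitCoeff R) w =
      ∑ l ∈ (rowsList n n).sublists'.toFinset with IsReducedWord w (l.map Prod.fst),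
        (l.map fun x => y x.2).prod := by
  have hnodup : (rowsList n n).Nodup := (pairwise_rowsList n n).imp ne_of_compatibleOrder
  rw [rowsProd_eq_prod_reverse, prod_reverse_one_add_smul,
    ← List.sum_toFinset _ (List.nodup_sublists'.2 hnodup), LinearMap.sum_apply,
    Finset.sum_apply, Finset.sum_filter]
  refine Finset.sum_congr rfl fun l _ => ?_
  have hword : (l.map fun x => nilOp R x.1) = (l.map Prod.fst).map (nilOp R) := by
    rw [List.map_map]
    rfl
  rw [LinearMap.smul_apply, Pi.smul_apply, hword, prod_reverse_nilOp_apply, smul_eq_mul, mul_ite,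
    mul_one, mul_zero]

theorem map_rowsProd_nilOp_apply (g : R →+* S) (y : ℕ → R) (n : ℕ) (w : SInf) :
    g (rowsProd (nilOp R) n y n (unitCoeff R) w) =
      rowsProd (nilOp S) n (fun i => g (y i)) n (unitCoeff S) w := by
  simp only [rowsProd_nilOp_apply, map_sum, map_list_prod, List.map_map]
  rfl

theorem mem_compatibleWords {w : SInf} {n : ℕ} (hn : FixesFrom n w) {l : List (ℕ × ℕ)} :
    l ∈ compatibleWords w ↔ l.Sublist (rowsList n n) ∧ IsReducedWord w (l.map Prod.fst) := by
  rw [sublist_rowsList, ← List.isChain_iff_pairwise]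
  constructor
  · rintro ⟨hred, hindex, hle, hletter⟩
    have hne := hred.isChain_ne
    refine ⟨⟨?_, fun x hx => ⟨hle x hx, ?_⟩⟩, hred⟩
    · rw [List.isChain_map] at hne
      rw [List.isChain_iff_getElem] at *
      intro i hi
      have := hindex i hi
      have := hletter i hi
      have := hne i hi
      unfold CompatibleOrder
      omega
    · have := hred.letter_lt hn x.1 (List.mem_map_of_mem hx)
      omega
  · rintro ⟨⟨hchain, hmem⟩, hred⟩
    refine ⟨hred, hchain.imp fun a b hab => ?_, fun x hx => (hmem x hx).1,
      hchain.imp fun a b hab => ?_⟩ <;>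
    · unfold CompatibleOrder at hab
      omega

/-- The Fomin–Stanley formula. -/
theorem schubert_eq_rowsProd {w : SInf} {n : ℕ} (hn : FixesFrom n w) :
    schubert w = rowsProd (nilOp _) n (X : ℕ → MvPolynomial ℕ ℤ) n (unitCoeff _) w := by
  classical
  have hset : compatibleWords w = ↑((rowsList n n).sublists'.toFinset.filter
      fun l => IsReducedWord w (l.map Prod.fst)) := by
    ext l
    simp [mem_compatibleWords hn]
  rw [rowsProd_nilOp_apply, schubert, hset, finsum_mem_coe_finset]

end NilCoxeterAction

/-! ### Divided differences -/

section Schubert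

open MvPolynomial NilCoxeter

section DividedDifference

variable {R : Type*} [CommRing R]

/-- The numerator `f - s_i f` of the `i`-th divided difference of `f`. -/
noncomputable def swapDiff (i : ℕ) : MvPolynomial ℕ R →ₗ[R] MvPolynomial ℕ R :=
  LinearMap.id - (rename (Equiv.swap i (i + 1))).toLinearMap

theorem swapDiff_apply (i : ℕ) (f : MvPolynomial ℕ R) :
    swapDiff i f = f - rename (Equiv.swap i (i + 1)) f := rfl

theorem swapDiff_eq_zero {i : ℕ} {f : MvPolynomial ℕ R} :
    swapDiff i f = 0 ↔ rename (Equiv.swap i (i + 1)) f = f := by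
  rw [swapDiff_apply, sub_eq_zero, eq_comm]

theorem swapDiff_one (i : ℕ) : swapDiff i (1 : MvPolynomial ℕ R) = 0 :=
  swapDiff_eq_zero.2 (map_one _)

theorem swapDiff_mul (i : ℕ) (f g : MvPolynomial ℕ R) :
    swapDiff i (f * g) = swapDiff i f * g + rename (Equiv.swap i (i + 1)) f * swapDiff i g := by
  simp only [swapDiff_apply, map_mul]
  ring

theorem lt_of_mem_vars_of_swapDiff_eq_zero {f : MvPolynomial ℕ R} {d : ℕ}
    (h : ∀ i, d ≤ i → swapDiff i f = 0) {i : ℕ} (hi : i ∈ f.vars) : i < d := by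
  by_contra! hdi
  have hmax := f.vars.max'_mem ⟨i, hi⟩
  have hle : ∀ j ∈ f.vars, j ≤ f.vars.max' ⟨i, hi⟩ := fun j hj => f.vars.le_max' j hj
  have hiM := hle i hi
  generalize f.vars.max' ⟨i, hi⟩ = M at *
  rw [← swapDiff_eq_zero.1 (h M (by omega))] at hmax
  obtain ⟨j, hj, hjM⟩ := mem_vars_rename _ _ hmax
  rw [Equiv.swap_apply_eq_iff, Equiv.swap_apply_left] at hjM
  have := hle _ hj
  omega

theorem ext_swapDiff {f g : MvPolynomial ℕ R} (hdiff : ∀ i, swapDiff i f = swapDiff i g)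
    (hconst : constantCoeff f = constantCoeff g) : f = g := by
  have hvars : (f - g).vars = ∅ := Finset.eq_empty_of_forall_notMem fun i hi =>
    (lt_of_mem_vars_of_swapDiff_eq_zero (fun i _ => by rw [map_sub, hdiff, sub_self]) hi).not_ge
      i.zero_le
  rw [vars_eq_empty_iff_eq_C] at hvars
  have hcoeff : coeff 0 (f - g) = 0 := by
    rw [coeff_sub, sub_eq_zero]
    exact hconst
  rwa [hcoeff, C_0, sub_eq_zero] at hvars

theorem X_sub_X_succ_ne_zero [Nontrivial R] (i : ℕ) :
    (X i - X (i + 1) : MvPolynomial ℕ R) ≠ 0 :=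
  sub_ne_zero.2 (X_injective.ne (Nat.succ_ne_self i).symm)

end DividedDifference

theorem swapDiff_schubert (w : SInf) (i : ℕ) : swapDiff i (schubert w) =
    (X i - X (i + 1)) * if w.1 (i + 1) < w.1 i then schubert (w * transp i (i + 1)) else 0 := by
  obtain ⟨n, hin, hn⟩ := exists_fixesFrom_ge w (i + 2)
  have hrename : rename (Equiv.swap i (i + 1)) (schubert w) = rowsProd (nilOp _) n
      (fun j => (X (Equiv.swap i (i + 1) j) : MvPolynomial ℕ ℤ)) n (unitCoeff _) w := by
    have hmap := map_rowsProd_nilOp_apply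
      (rename (R := ℤ) (Equiv.swap i (i + 1)) : _ →ₐ[ℤ] MvPolynomial ℕ ℤ).toRingHom X n w
    simp only [AlgHom.toRingHom_eq_coe, RingHom.coe_coe, rename_X] at hmap
    rw [schubert_eq_rowsProd hn, hmap]
  have hoperator := (nilCoxeter_nilOp (R := MvPolynomial ℕ ℤ)).rowsProd_sub_swap
    (X : ℕ → MvPolynomial ℕ ℤ) hin le_rfl
  have hrows := congrFun (LinearMap.congr_fun hoperator (unitCoeff _)) w
  rw [swapDiff_apply, hrename, schubert_eq_rowsProd hn,
    schubert_eq_rowsProd (hn.mul_transp (a := i) (b := i + 1) (by omega) (by omega))]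
  simpa only [Module.End.mul_apply, nilOp_apply, LinearMap.sub_apply, LinearMap.smul_apply,
    Pi.sub_apply, Pi.smul_apply, smul_eq_mul] using hrows

theorem swapDiff_schubert_of_lt {w : SInf} {i : ℕ} (h : w.1 i < w.1 (i + 1)) :
    swapDiff i (schubert w) = 0 := by
  rw [swapDiff_schubert, if_neg h.asymm, mul_zero]

theorem swapDiff_schubert_of_gt {w : SInf} {i : ℕ} (h : w.1 (i + 1) < w.1 i) :
    swapDiff i (schubert w) = (X i - X (i + 1)) * schubert (w * transp i (i + 1)) := by
  rw [swapDiff_schubert, if_pos h]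

theorem lt_of_mem_vars_schubert {w : SInf} {n : ℕ} (h : AscendsFrom n w) {i : ℕ}
    (hi : i ∈ (schubert w).vars) : i < n :=
  lt_of_mem_vars_of_swapDiff_eq_zero (fun i hi => swapDiff_schubert_of_lt (h i hi)) hi

open Classical in
theorem constantCoeff_schubert (w : SInf) :
    constantCoeff (schubert w) = if w = 1 then 1 else 0 := by
  obtain ⟨n, -, hn⟩ := exists_fixesFrom_ge w 0
  rw [schubert_eq_rowsProd hn, map_rowsProd_nilOp_apply]
  simp only [constantCoeff_X]
  rw [rowsProd_zero_left, Module.End.one_apply, unitCoeff, Pi.single_apply]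

theorem schubert_one : schubert 1 = 1 := by
  refine ext_swapDiff (fun i => ?_) ?_
  · rw [swapDiff_schubert_of_lt (Nat.lt_succ_self i), swapDiff_one]
  · rw [constantCoeff_schubert, if_pos rfl, map_one]

/-! ### Expansions into Schubert polynomials -/

theorem swapDiff_linearCombination_schubert (c : SInf →₀ ℤ) (i : ℕ) :
    swapDiff i (Finsupp.linearCombination ℤ schubert c) =
      (X i - X (i + 1)) * Finsupp.linearCombination ℤ schubert
        ((c.filter fun v => v.1 (i + 1) < v.1 i).mapDomain (· * transp i (i + 1))) := by
  induction c using Finsupp.induction_linear with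
  | zero => simp [Finsupp.filter_zero]
  | add c d hc hd =>
    rw [map_add, map_add, hc, hd, Finsupp.filter_add, Finsupp.mapDomain_add, map_add, mul_add]
  | single v a =>
    rw [Finsupp.linearCombination_single, map_zsmul]
    rcases lt_or_gt_succ v i with h | h
    · rw [swapDiff_schubert_of_lt h, Finsupp.filter_single_of_neg
        (fun v : SInf => v.1 (i + 1) < v.1 i) h.asymm]
      simp
    · rw [swapDiff_schubert_of_gt h,
        Finsupp.filter_single_of_pos (fun v : SInf => v.1 (i + 1) < v.1 i) h,
        Finsupp.mapDomain_single, Finsupp.linearCombination_single, mul_smul_comm]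

theorem linearIndependent_schubert : LinearIndependent ℤ schubert := by
  classical
  refine linearIndependent_iff.2 fun c hc => Finsupp.ext fun v => ?_
  induction hl : length v generalizing c v with
  | zero =>
    obtain rfl := length_eq_zero.1 hl
    have hconst := congrArg constantCoeff hc
    rw [Finsupp.linearCombination_apply, Finsupp.sum, map_sum] at hconst
    simpa [constantCoeff_schubert] using hconst
  | succ n ih =>
    have hv : v ≠ 1 := fun hv => by
      rw [hv, length_one] at hl
      omega
    obtain ⟨i, hi⟩ := exists_descent hv
    have hdiff := swapDiff_linearCombination_schubert c i
    rw [hc, map_zero, eq_comm, mul_eq_zero_iff_left (X_sub_X_succ_ne_zero i)] at hdiff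
    have hlen := length_mul_transp_adj_of_gt hi
    have := ih _ hdiff (v * transp i (i + 1)) (by omega)
    rwa [Finsupp.mapDomain_apply (mul_left_injective _),
      Finsupp.filter_apply_pos (fun z : SInf => z.1 (i + 1) < z.1 i) c hi] at this

theorem IsSchubertExpansion.schubertExpansion_eq {f : MvPolynomial ℕ ℤ} {c : SInf →₀ ℤ}
    (h : IsSchubertExpansion f c) : schubertExpansion f = c := by
  have hspec : IsSchubertExpansion f (schubertExpansion f) :=
    Classical.epsilon_spec (p := IsSchubertExpansion f) ⟨c, h⟩
  exact linearIndependent_schubert (hspec.symm.trans h)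

/-! ### Products of Schubert polynomials -/

theorem mul_eq_one_iff_of_fixes {a b : SInf} {p : ℕ} (ha : FixesFrom p a) (hb : FixesBelow p b) :
    a * b = 1 ↔ a = 1 ∧ b = 1 := by
  refine ⟨fun h => ?_, fun ⟨ha, hb⟩ => by rw [ha, hb, mul_one]⟩
  have hb_one : b = 1 := by
    ext i
    rcases lt_or_ge i p with hi | hi
    · exact hb i hi
    · have hab : (a * b).1 i = i := by rw [h, one_apply]
      rwa [mul_apply, ha _ (hb.le_apply hi)] at hab
  exact ⟨by rwa [hb_one, mul_one] at h, hb_one⟩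

theorem swapDiff_schubert_mul_of_lt {a b : SInf} {p i : ℕ} (hb : FixesBelow p b)
    (hip : i + 1 < p) (ih : (a * b).1 (i + 1) < (a * b).1 i →
      schubert (a * transp i (i + 1) * b) = schubert (a * transp i (i + 1)) * schubert b) :
    swapDiff i (schubert (a * b)) = swapDiff i (schubert a * schubert b) := by
  have hbi : b.1 i = i := hb i (by omega)
  have hbi' : b.1 (i + 1) = i + 1 := hb (i + 1) hip
  have hcomm : a * b * transp i (i + 1) = a * transp i (i + 1) * b := by
    rw [mul_assoc, mul_transp_eq_transp_mul, hbi, hbi', mul_assoc]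
  rw [swapDiff_mul, swapDiff_schubert_of_lt (w := b) (by omega), mul_zero, add_zero]
  simp only [mul_apply, hbi, hbi'] at ih
  rcases lt_or_gt_succ a i with h | h
  · rw [swapDiff_schubert_of_lt h, swapDiff_schubert_of_lt, zero_mul]
    rwa [mul_apply, mul_apply, hbi, hbi']
  · rw [swapDiff_schubert_of_gt h, swapDiff_schubert_of_gt, hcomm, ih h, mul_assoc]
    rwa [mul_apply, mul_apply, hbi, hbi']

theorem swapDiff_schubert_mul_of_ge {a b : SInf} {p i : ℕ} (ha : FixesFrom p a)
    (hb : FixesBelow p b) (hpi : p ≤ i) (ih : (a * b).1 (i + 1) < (a * b).1 i →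
      schubert (a * (b * transp i (i + 1))) = schubert a * schubert (b * transp i (i + 1))) :
    swapDiff i (schubert (a * b)) = swapDiff i (schubert a * schubert b) := by
  have hai : a.1 i = i := ha i hpi
  have hai' : a.1 (i + 1) = i + 1 := ha (i + 1) (by omega)
  have ha_diff : swapDiff i (schubert a) = 0 := swapDiff_schubert_of_lt (by omega)
  rw [swapDiff_mul, ha_diff, zero_mul, zero_add, swapDiff_eq_zero.1 ha_diff]
  have hab : (a * b).1 i = b.1 i := ha _ (hb.le_apply hpi)
  have hab' : (a * b).1 (i + 1) = b.1 (i + 1) := ha _ (hb.le_apply (by omega))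
  rw [hab, hab'] at ih
  rcases lt_or_gt_succ b i with h | h
  · rw [swapDiff_schubert_of_lt h, swapDiff_schubert_of_lt, mul_zero]
    rwa [hab, hab']
  · rw [swapDiff_schubert_of_gt h, swapDiff_schubert_of_gt, mul_assoc, ih h, mul_left_comm]
    rwa [hab, hab']

theorem schubert_mul {a b : SInf} {p : ℕ} (ha : FixesFrom p a) (hb : FixesBelow p b) :
    schubert (a * b) = schubert a * schubert b := by
  induction hn : length (a * b) using Nat.strong_induction_on generalizing a b with
  | _ n ih =>
  subst hn
  refine ext_swapDiff (fun i => ?_) ?_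
  · rcases lt_trichotomy (i + 1) p with hip | rfl | hip
    · refine swapDiff_schubert_mul_of_lt hb hip fun h => ?_
      have hcomm : a * b * transp i (i + 1) = a * transp i (i + 1) * b := by
        rw [mul_assoc, mul_transp_eq_transp_mul, hb i (by omega), hb (i + 1) hip, mul_assoc]
      have hlen := length_mul_transp_adj_of_gt h
      exact ih _ (by rw [← hcomm]; omega) (ha.mul_transp (by omega) hip) hb rfl
    · have ha_lt := ha.apply_lt (Nat.lt_succ_self i)
      have hb_le := hb.le_apply (le_refl (i + 1))
      have ha_fix := ha (i + 1) le_rfl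
      have hb_fix := hb i (Nat.lt_succ_self i)
      have hab_fix : (a * b).1 (i + 1) = b.1 (i + 1) := ha _ hb_le
      rw [swapDiff_mul, swapDiff_schubert_of_lt (w := a) (by omega),
        swapDiff_schubert_of_lt (w := b) (by omega), zero_mul, mul_zero, add_zero,
        swapDiff_schubert_of_lt]
      rw [hab_fix, mul_apply, hb_fix]
      omega
    · refine swapDiff_schubert_mul_of_ge ha hb (by omega) fun h => ?_
      have hlen := length_mul_transp_adj_of_gt h
      exact ih _ (by rw [← mul_assoc]; omega) ha (hb.mul_transp (by omega) (by omega)) rfl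
  · rw [map_mul, constantCoeff_schubert, constantCoeff_schubert, constantCoeff_schubert]
    have hab := mul_eq_one_iff_of_fixes ha hb
    split_ifs <;> simp_all

end Schubert

/-! ### Direct sums -/

theorem directSum_apply_lt {p : ℕ} (w : Equiv.Perm (Fin p)) (v : SInf) {i : ℕ} (h : i < p) :
    (directSum w v).1 i = w ⟨i, h⟩ := by
  simp only [directSum]
  rw [Equiv.permCongr_apply, finSumNatEquiv_symm_apply_of_lt h, Equiv.sumCongr_apply, Sum.map_inl,
    finSumNatEquiv_apply_left]

theorem directSum_apply_ge {p : ℕ} (w : Equiv.Perm (Fin p)) (v : SInf) {i : ℕ} (h : p ≤ i) :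
    (directSum w v).1 i = p + v.1 (i - p) := by
  simp only [directSum]
  rw [Equiv.permCongr_apply, finSumNatEquiv_symm_apply_of_ge h, Equiv.sumCongr_apply, Sum.map_inr,
    finSumNatEquiv_apply_right]

theorem ones_apply (n : ℕ) (v : SInf) (i : ℕ) :
    (ones n v).1 i = if i < n then i else n + v.1 (i - n) := by
  split_ifs with h
  · exact directSum_apply_lt _ _ h
  · exact directSum_apply_ge _ _ (not_lt.1 h)

theorem ones_apply_add (n : ℕ) (v : SInf) (i : ℕ) : (ones n v).1 (n + i) = n + v.1 i := by
  rw [ones_apply, if_neg (by omega), Nat.add_sub_cancel_left]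

theorem fixesBelow_ones (n : ℕ) (v : SInf) : FixesBelow n (ones n v) :=
  fun i hi => by rw [ones_apply, if_pos hi]

theorem ones_ones (a b : ℕ) (v : SInf) : ones a (ones b v) = ones (a + b) v := by
  ext i
  rw [ones_apply, ones_apply, ones_apply, Nat.sub_sub]
  split_ifs <;> omega

theorem ones_zero (v : SInf) : ones 0 v = v := by
  ext i
  rw [ones_apply, if_neg i.not_lt_zero, Nat.sub_zero, zero_add]

theorem ones_one (n : ℕ) : ones n 1 = 1 := by
  ext i
  rw [ones_apply, one_apply, one_apply]
  split_ifs <;> omega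

theorem ones_injective (n : ℕ) : Function.Injective (ones n) := by
  intro v v' h
  ext i
  have := congrArg (fun z : SInf => z.1 (n + i)) h
  simp only [ones_apply_add] at this
  omega

theorem ones_eq_one {n : ℕ} {v : SInf} : ones n v = 1 ↔ v = 1 :=
  ⟨fun h => ones_injective n (h.trans (ones_one n).symm), fun h => h ▸ ones_one n⟩

theorem ones_mul_transp (n : ℕ) (v : SInf) (i j : ℕ) :
    ones n (v * transp i j) = ones n v * transp (n + i) (n + j) := by
  ext k
  simp only [mul_apply, ones_apply, transp_apply]
  grind

theorem ones_apply_add_lt_iff (n : ℕ) (v : SInf) (i j : ℕ) :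
    (ones n v).1 (n + i) < (ones n v).1 (n + j) ↔ v.1 i < v.1 j := by
  rw [ones_apply_add, ones_apply_add, Nat.add_lt_add_iff_left]

theorem FixesBelow.inv {n : ℕ} {z : SInf} (h : FixesBelow n z) : FixesBelow n z⁻¹ :=
  fun i hi => z.1.symm_apply_eq.2 (h i hi).symm

theorem FixesBelow.exists_eq_ones {n : ℕ} {z : SInf} (h : FixesBelow n z) : ∃ v, z = ones n v := by
  have hle (i : ℕ) : n ≤ z.1 (n + i) := h.le_apply (Nat.le_add_right n i)
  have hle_inv (i : ℕ) : n ≤ z⁻¹.1 (n + i) := h.inv.le_apply (Nat.le_add_right n i)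
  let e : Equiv.Perm ℕ :=
    { toFun := fun i => z.1 (n + i) - n
      invFun := fun i => z⁻¹.1 (n + i) - n
      left_inv := fun i => by
        dsimp only
        rw [Nat.add_sub_cancel' (hle i), show z⁻¹.1 (z.1 (n + i)) = n + i from
          z.1.symm_apply_apply _, Nat.add_sub_cancel_left]
      right_inv := fun i => by
        dsimp only
        rw [Nat.add_sub_cancel' (hle_inv i), show z.1 (z⁻¹.1 (n + i)) = n + i from
          z.1.apply_symm_apply _, Nat.add_sub_cancel_left] }
  have he : e ∈ SInf := by
    obtain ⟨N, -, hN⟩ := exists_fixesFrom_ge z 0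
    refine (Set.finite_lt_nat N).subset fun i hi => Set.mem_ofPred.2 <| not_le.1 fun hNi => hi ?_
    change z.1 (n + i) - n = i
    rw [hN _ (by omega), Nat.add_sub_cancel_left]
  refine ⟨⟨e, he⟩, ?_⟩
  ext i
  rw [ones_apply]
  split_ifs with hi
  · exact h i hi
  · change z.1 i = n + (z.1 (n + (i - n)) - n)
    rw [Nat.add_sub_cancel' (hle _), Nat.add_sub_cancel' (not_lt.1 hi)]

/-! ### Setting variables to zero -/

section SetToZero

open MvPolynomial

section Semiring

variable {R : Type*} [CommSemiring R]

/-- Set `x_j = 0` and close the gap. -/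
noncomputable def delVar (j : ℕ) : MvPolynomial ℕ R →ₐ[R] MvPolynomial ℕ R :=
  aeval fun i => if i < j then X i else if i = j then 0 else X (i - 1)

/-- Set the variables `x_d, x_{d+1}, …` to zero. -/
noncomputable def trunc (d : ℕ) : MvPolynomial ℕ R →ₐ[R] MvPolynomial ℕ R :=
  aeval fun i => if i < d then X i else 0

theorem delVar_X (j i : ℕ) :
    delVar j (X i : MvPolynomial ℕ R) = if i < j then X i else if i = j then 0 else X (i - 1) :=
  aeval_X _ _

theorem trunc_X (d i : ℕ) : trunc d (X i : MvPolynomial ℕ R) = if i < d then X i else 0 :=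
  aeval_X _ _

theorem delVar_zero_rename (i : ℕ) (f : MvPolynomial ℕ R) :
    delVar 0 (rename (Equiv.swap (i + 1) (i + 1 + 1)) f) =
      rename (Equiv.swap i (i + 1)) (delVar 0 f) := by
  suffices h : (delVar 0).comp (rename (R := R) (Equiv.swap (i + 1) (i + 1 + 1))) =
      (rename (Equiv.swap i (i + 1))).comp (delVar 0) from DFunLike.congr_fun h f
  refine algHom_ext fun k => ?_
  simp only [AlgHom.comp_apply, rename_X, delVar_X, Nat.not_lt_zero, if_false]
  rcases k with _ | k
  · rw [Equiv.swap_apply_of_ne_of_ne (by omega) (by omega), if_pos rfl, map_zero]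
  · rw [if_neg k.succ_ne_zero, rename_X, Equiv.swap_apply_def, Equiv.swap_apply_def]
    rcases eq_or_ne k i with rfl | hki
    · simp
    · rcases eq_or_ne k (i + 1) with rfl | hki' <;> simp [*]

theorem delVar_succ (j : ℕ) {f : MvPolynomial ℕ R} (h : rename (Equiv.swap j (j + 1)) f = f) :
    delVar (j + 1) f = delVar j f := by
  conv_rhs => rw [← h]
  suffices h : delVar (j + 1) = (delVar j).comp (rename (R := R) (Equiv.swap j (j + 1))) from
    DFunLike.congr_fun h f
  refine algHom_ext fun k => ?_
  simp only [AlgHom.comp_apply, rename_X, delVar_X, Equiv.swap_apply_def]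
  split_ifs <;> first | rfl | omega | exact congrArg X (by omega)

theorem delVar_eq_delVar_zero {d : ℕ} {f : MvPolynomial ℕ R}
    (h : ∀ i < d, rename (Equiv.swap i (i + 1)) f = f) : delVar d f = delVar 0 f := by
  induction d with
  | zero => rfl
  | succ d ih =>
    rw [delVar_succ d (h d (Nat.lt_succ_self d)), ih fun i hi => h i (Nat.lt_succ_of_lt hi)]

theorem trunc_delVar (d : ℕ) (f : MvPolynomial ℕ R) : trunc d (delVar d f) = trunc d f := by
  suffices h : (trunc d).comp (delVar d) = trunc (R := R) d from DFunLike.congr_fun h f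
  refine algHom_ext fun k => ?_
  simp only [AlgHom.comp_apply, trunc_X, delVar_X]
  split_ifs with h1 h2
  · rw [trunc_X, if_pos h1]
  · exact map_zero _
  · rw [trunc_X, if_neg (by omega)]

theorem trunc_eq_self {d : ℕ} {f : MvPolynomial ℕ R} (h : ∀ i ∈ f.vars, i < d) :
    trunc d f = f := by
  conv_rhs => rw [← aeval_X_left_apply f]
  refine eval₂Hom_congr' rfl (fun i hi _ => ?_) rfl
  rw [if_pos (h i hi)]

theorem trunc_monomial_eq_zero {d : ℕ} {e : ℕ →₀ ℕ} (he : ¬ ∀ i ∈ e.support, i < d) (a : R) :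
    trunc d (monomial e a) = 0 := by
  push Not at he
  obtain ⟨i, hi, hdi⟩ := he
  rw [trunc, aeval_monomial, Finsupp.prod, Finset.prod_eq_zero hi, mul_zero]
  rw [if_neg hdi.not_gt, zero_pow (Finsupp.mem_support_iff.1 hi)]

theorem coeff_trunc {d : ℕ} (f : MvPolynomial ℕ R) {e : ℕ →₀ ℕ} (he : ∀ i ∈ e.support, i < d) :
    coeff e (trunc d f) = coeff e f := by
  classical
  induction f using MvPolynomial.induction_on' with
  | add p q hp hq => rw [map_add, coeff_add, coeff_add, hp, hq]
  | monomial u a =>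
    by_cases hu : ∀ i ∈ u.support, i < d
    · rw [trunc_eq_self fun i hi => ?_]
      obtain ⟨v, hv, hiv⟩ := (mem_vars_iff_mem_support i).1 hi
      rw [Finset.mem_singleton.1 (support_monomial_subset hv)] at hiv
      exact hu i hiv
    · rw [trunc_monomial_eq_zero hu, coeff_zero, coeff_monomial, if_neg]
      rintro rfl
      exact hu he

theorem constantCoeff_delVar_zero (f : MvPolynomial ℕ R) :
    constantCoeff (delVar 0 f) = constantCoeff f := by
  suffices h : constantCoeff.comp (delVar 0).toRingHom = constantCoeff (R := R) from
    DFunLike.congr_fun h f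
  refine ringHom_ext (fun a => ?_) fun i => ?_
  · simp
  · simp only [AlgHom.toRingHom_eq_coe, RingHom.coe_comp, RingHom.coe_coe, Function.comp_apply,
      delVar_X]
    split_ifs <;> simp

end Semiring

theorem swapDiff_delVar_zero {R : Type*} [CommRing R] (i : ℕ) (f : MvPolynomial ℕ R) :
    swapDiff i (delVar 0 f) = delVar 0 (swapDiff (i + 1) f) := by
  rw [swapDiff_apply, swapDiff_apply, map_sub, delVar_zero_rename]

theorem delVar_zero_schubert_ones (v : SInf) : delVar 0 (schubert (ones 1 v)) = schubert v := by
  classical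
  induction hn : length v using Nat.strong_induction_on generalizing v with
  | _ n ih =>
  refine ext_swapDiff (fun i => ?_) ?_
  · rw [swapDiff_delVar_zero, swapDiff_schubert, swapDiff_schubert]
    simp only [add_comm _ 1, ones_apply_add_lt_iff, ← ones_mul_transp]
    split_ifs with h
    · rw [add_comm] at h
      have hlen := length_mul_transp_adj_of_gt h
      rw [map_mul, add_comm 1 i, ih _ (hn ▸ hlen ▸ Nat.lt_succ_self _) _ rfl]
      simp [delVar_X, add_comm 1]
    · simp
  · rw [constantCoeff_delVar_zero, constantCoeff_schubert, constantCoeff_schubert]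
    simp only [ones_eq_one]

theorem delVar_zero_schubert_of_ne {z : SInf} (hz : z.1 0 ≠ 0) : delVar 0 (schubert z) = 0 := by
  induction hn : length z using Nat.strong_induction_on generalizing z with
  | _ n ih =>
  refine ext_swapDiff (fun i => ?_) ?_
  · rw [swapDiff_delVar_zero, map_zero]
    rcases lt_or_gt_succ z (i + 1) with h | h
    · rw [swapDiff_schubert_of_lt h, map_zero]
    · have hlen := length_mul_transp_adj_of_gt h
      rw [swapDiff_schubert_of_gt h, map_mul, ih _ (by omega) ?_ rfl, mul_zero]
      rwa [mul_transp_apply_of_ne _ (by omega) (by omega)]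
  · rw [constantCoeff_delVar_zero, constantCoeff_schubert, map_zero, if_neg]
    rintro rfl
    exact hz rfl

theorem AscendsBelow.ones {v : SInf} {d : ℕ} (h : AscendsBelow d v) (p : ℕ) :
    AscendsBelow (p + d) (ones p v) := by
  intro i hi
  rcases lt_or_ge i p with hip | hip
  · rw [fixesBelow_ones p v i hip]
    rcases Nat.lt_or_ge (i + 1) p with hip' | hip'
    · rw [fixesBelow_ones p v _ hip']
      omega
    · exact hip.trans_le ((fixesBelow_ones p v).le_apply hip')
  · obtain ⟨k, rfl⟩ := Nat.exists_eq_add_of_le hip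
    rw [add_assoc, ones_apply_add_lt_iff]
    exact h k (by omega)

theorem AscendsFrom.ones {v : SInf} {d : ℕ} (h : AscendsFrom d v) (p : ℕ) :
    AscendsFrom (p + d) (ones p v) := by
  intro i hi
  obtain ⟨k, rfl⟩ := Nat.exists_eq_add_of_le ((Nat.le_add_right p d).trans hi)
  rw [add_assoc, ones_apply_add_lt_iff]
  exact h k (by omega)

theorem AscendsFrom.trunc_schubert {v : SInf} {d : ℕ} (h : AscendsFrom d v) :
    trunc d (schubert v) = schubert v :=
  trunc_eq_self fun _ hi => lt_of_mem_vars_schubert h hi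

theorem trunc_schubert_ones_one {v : SInf} {d : ℕ} (h : AscendsBelow d v) :
    trunc d (schubert (ones 1 v)) = trunc d (schubert v) := by
  rw [← delVar_zero_schubert_ones v, ← trunc_delVar, delVar_eq_delVar_zero fun i hi =>
    swapDiff_eq_zero.1 (swapDiff_schubert_of_lt (h.ones 1 i (by omega)))]

theorem trunc_schubert_ones {v : SInf} {d : ℕ} (h : AscendsBelow d v) (p : ℕ) :
    trunc d (schubert (ones p v)) = trunc d (schubert v) := by
  induction p with
  | zero => rw [ones_zero]
  | succ p ih =>
    rw [add_comm p 1, ← ones_ones, trunc_schubert_ones_one, ih]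
    exact fun i hi => h.ones p i (by omega)

end SetToZero

/-! ### Monk's formula -/

section Monk

open MvPolynomial

theorem isCover_and_descent_iff {w : SInf} {a b i : ℕ} (hab : a < b)
    (hne : ¬ (a = i ∧ b = i + 1)) :
    (IsCover w a b ∧ (w * transp a b).1 (i + 1) < (w * transp a b).1 i) ↔
      (w.1 (i + 1) < w.1 i ∧
        IsCover (w * transp i (i + 1)) (Equiv.swap i (i + 1) a) (Equiv.swap i (i + 1) b)) := by
  have hinj (j k : ℕ) : w.1 j = w.1 k ↔ j = k := apply_inj w
  have := hinj a i
  have := hinj a (i + 1)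
  have := hinj b i
  have := hinj b (i + 1)
  have := hinj i (i + 1)
  have := hinj a b
  simp only [IsCover, mul_apply, transp_apply, Equiv.swap_apply_def]
  constructor
  · rintro ⟨⟨-, hw, hbetween⟩, hdesc⟩
    have := hbetween i
    have := hbetween (i + 1)
    refine ⟨?_, ?_, ?_, fun c _ _ => ?_⟩
    · grind
    · grind
    · grind
    · have := hbetween c
      grind
  · rintro ⟨hdesc, -, hw, hbetween⟩
    have := hbetween i
    have := hbetween (i + 1)
    refine ⟨⟨hab, ?_, fun c _ _ => ?_⟩, ?_⟩
    · grind
    · have := hbetween c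
      grind
    · grind

open Classical in
/-- The contribution of the transposition of `a` and `b` to Monk's formula for `w`: the Schubert
polynomial of `w t_{ab}` if this covers `w`, and `0` otherwise. -/
noncomputable def coverTerm (w : SInf) (a b : ℕ) : MvPolynomial ℕ ℤ :=
  if IsCover w a b then schubert (w * transp a b) else 0

theorem coverTerm_of_le {w : SInf} {a b : ℕ} (h : b ≤ a) : coverTerm w a b = 0 :=
  if_neg fun hcover => hcover.1.not_ge h

theorem coverTerm_succ (w : SInf) (i : ℕ) : coverTerm w i (i + 1) =
    if w.1 i < w.1 (i + 1) then schubert (w * transp i (i + 1)) else 0 := by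
  have hcover : IsCover w i (i + 1) ↔ w.1 i < w.1 (i + 1) :=
    ⟨fun h => h.2.1, fun h => ⟨i.lt_succ_self, h, fun c _ _ => by omega⟩⟩
  rw [coverTerm]
  simp only [hcover]

theorem constantCoeff_coverTerm (w : SInf) (a b : ℕ) : constantCoeff (coverTerm w a b) = 0 := by
  classical
  rw [coverTerm]
  split_ifs with h
  · rw [constantCoeff_schubert, if_neg fun h1 => ?_]
    have := h.length_eq
    rw [h1, length_one] at this
    omega
  · exact map_zero _

theorem swapDiff_coverTerm {w : SInf} {a b i : ℕ} (hab : ¬ (a = i ∧ b = i + 1))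
    (hba : ¬ (b = i ∧ a = i + 1)) :
    swapDiff i (coverTerm w a b) = (X i - X (i + 1)) *
      if w.1 (i + 1) < w.1 i then
        coverTerm (w * transp i (i + 1)) (Equiv.swap i (i + 1) a) (Equiv.swap i (i + 1) b)
      else 0 := by
  rcases lt_or_ge a b with hlt | hle
  · have hiff := isCover_and_descent_iff (w := w) hlt hab
    by_cases h : IsCover w a b ∧ (w * transp a b).1 (i + 1) < (w * transp a b).1 i
    · rw [coverTerm, if_pos h.1, swapDiff_schubert_of_gt h.2, mul_transp_mul_transp,
        if_pos (hiff.1 h).1, coverTerm, if_pos (hiff.1 h).2]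
    · have hleft : swapDiff i (coverTerm w a b) = 0 := by
        rw [coverTerm]
        split_ifs with hcover
        · exact swapDiff_schubert_of_lt
            ((lt_or_gt_succ _ i).resolve_right fun hdesc => h ⟨hcover, hdesc⟩)
        · exact map_zero _
      rw [hleft, coverTerm, ← ite_and, if_neg fun h' => h (hiff.2 h'), mul_zero]
  · have hle_swap : Equiv.swap i (i + 1) b ≤ Equiv.swap i (i + 1) a := by
      rw [Equiv.swap_apply_def, Equiv.swap_apply_def]
      split_ifs <;> omega
    rw [coverTerm_of_le hle, coverTerm_of_le hle_swap, ite_self, mul_zero, map_zero]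

theorem swapDiff_coverTerm_succ (w : SInf) (i : ℕ) :
    swapDiff i (coverTerm w i (i + 1)) = (X i - X (i + 1)) * (schubert w -
      if w.1 (i + 1) < w.1 i then coverTerm (w * transp i (i + 1)) i (i + 1) else 0) := by
  rw [coverTerm_succ, coverTerm_succ, mul_transp_apply_left, mul_transp_apply_right,
    mul_transp_cancel]
  rcases lt_or_gt_succ w i with h | h
  · rw [if_pos h, if_neg h.asymm, sub_zero, swapDiff_schubert_of_gt, mul_transp_cancel]
    rwa [mul_transp_apply_left, mul_transp_apply_right]
  · rw [if_neg h.asymm, if_pos h, if_pos h, sub_self, mul_zero, map_zero]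

/-- The signed contribution of the transposition of `r` and `k` to Monk's formula for
`x_r 𝔖_w`. -/
noncomputable def monkTerm (w : SInf) (r k : ℕ) : MvPolynomial ℕ ℤ :=
  coverTerm w r k - coverTerm w k r

theorem constantCoeff_monkTerm (w : SInf) (r k : ℕ) : constantCoeff (monkTerm w r k) = 0 := by
  rw [monkTerm, map_sub, constantCoeff_coverTerm, constantCoeff_coverTerm, sub_zero]

/-- The coefficient of `𝔖_w` in the `i`-th divided difference of `monkTerm w r k`. -/
def adjSign {R : Type*} [Ring R] (i r k : ℕ) : R :=
  (if r = i ∧ k = i + 1 then 1 else 0) - if r = i + 1 ∧ k = i then 1 else 0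

theorem adjSign_self_succ {R : Type*} [Ring R] (i : ℕ) : (adjSign i i (i + 1) : R) = 1 := by
  rw [adjSign, if_pos ⟨rfl, rfl⟩, if_neg (by omega), sub_zero]

theorem adjSign_succ_self {R : Type*} [Ring R] (i : ℕ) : (adjSign i (i + 1) i : R) = -1 := by
  rw [adjSign, if_pos (c := i + 1 = i + 1 ∧ _) ⟨rfl, rfl⟩, if_neg (by omega), zero_sub]

theorem swapDiff_monkTerm (w : SInf) (r k i : ℕ) :
    swapDiff i (monkTerm w r k) = (X i - X (i + 1)) * (adjSign i r k * schubert w +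
      if w.1 (i + 1) < w.1 i then
        monkTerm (w * transp i (i + 1)) (Equiv.swap i (i + 1) r) (Equiv.swap i (i + 1) k)
      else 0) := by
  rw [monkTerm, map_sub, monkTerm]
  by_cases hrk : r = i ∧ k = i + 1
  · obtain ⟨rfl, rfl⟩ := hrk
    rw [swapDiff_coverTerm_succ, coverTerm_of_le r.le_succ, Equiv.swap_apply_left,
      Equiv.swap_apply_right, coverTerm_of_le r.le_succ, adjSign_self_succ, map_zero]
    split_ifs <;> ring
  by_cases hkr : r = i + 1 ∧ k = i
  · obtain ⟨rfl, rfl⟩ := hkr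
    rw [swapDiff_coverTerm_succ, coverTerm_of_le k.le_succ, Equiv.swap_apply_left,
      Equiv.swap_apply_right, coverTerm_of_le k.le_succ, adjSign_succ_self, map_zero]
    split_ifs <;> ring
  rw [adjSign, if_neg hrk, if_neg hkr, swapDiff_coverTerm hrk (by omega),
    swapDiff_coverTerm (by omega) (by omega)]
  split_ifs <;> ring

theorem swapDiff_X {R : Type*} [CommRing R] {i n : ℕ} (hi : i + 1 < n) (r : ℕ) :
    swapDiff i (X r : MvPolynomial ℕ R) =
      (X i - X (i + 1)) * ∑ k ∈ Finset.range n, adjSign i r k := by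
  have hi_mem : i ∈ Finset.range n := Finset.mem_range.2 (by omega)
  have hi_mem' : i + 1 ∈ Finset.range n := Finset.mem_range.2 hi
  simp only [swapDiff_apply, rename_X, adjSign, Finset.sum_sub_distrib, ite_and,
    Finset.sum_ite_irrel, Finset.sum_ite_eq', Finset.sum_const_zero, if_pos hi_mem,
    if_pos hi_mem', Equiv.swap_apply_def]
  split_ifs <;> first | omega | (subst_vars; ring)

theorem sum_range_swap {M : Type*} [AddCommMonoid M] {i n : ℕ} (hi : i + 1 < n) (f : ℕ → M) :
    ∑ k ∈ Finset.range n, f (Equiv.swap i (i + 1) k) = ∑ k ∈ Finset.range n, f k := by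
  refine Finset.sum_equiv (Equiv.swap i (i + 1)) (fun j => ?_) fun _ _ => rfl
  simp only [Finset.mem_range, Equiv.swap_apply_def]
  split_ifs <;> omega

theorem swapDiff_coverTerm_of_ge {w : SInf} {a b n i : ℕ} (hn : FixesFrom n w) (ha : a ≤ n)
    (hb : b ≤ n) (hi : n ≤ i) : swapDiff i (coverTerm w a b) = 0 := by
  rw [coverTerm]
  split_ifs
  · refine swapDiff_schubert_of_lt ?_
    have hfix : FixesFrom (n + 1) (w * transp a b) :=
      (hn.mono n.le_succ).mul_transp (Nat.lt_succ_of_le ha) (Nat.lt_succ_of_le hb)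
    rw [hfix (i + 1) (Nat.succ_le_succ hi)]
    exact (hfix.mono (Nat.succ_le_succ hi)).apply_lt i.lt_succ_self
  · exact map_zero _

theorem swapDiff_monkTerm_of_ge {w : SInf} {r k n i : ℕ} (hn : FixesFrom n w) (hr : r ≤ n)
    (hk : k ≤ n) (hi : n ≤ i) : swapDiff i (monkTerm w r k) = 0 := by
  rw [monkTerm, map_sub, swapDiff_coverTerm_of_ge hn hr hk hi,
    swapDiff_coverTerm_of_ge hn hk hr hi, sub_zero]

theorem X_mul_schubert {w : SInf} {r n : ℕ} (hn : FixesFrom n w) (hr : r < n) :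
    X r * schubert w = ∑ k ∈ Finset.range (n + 1), monkTerm w r k := by
  induction hl : length w using Nat.strong_induction_on generalizing w r with
  | _ l ih =>
  subst hl
  refine ext_swapDiff (fun i => ?_) ?_
  · rw [swapDiff_mul, rename_X, map_sum]
    rcases lt_or_ge i n with hi | hi
    · simp only [swapDiff_monkTerm]
      rw [swapDiff_X (Nat.succ_lt_succ hi), ← Finset.mul_sum, Finset.sum_add_distrib,
        ← Finset.sum_mul, mul_add, mul_assoc, add_right_inj]
      rcases lt_or_gt_succ w i with h | h
      · simp only [swapDiff_schubert_of_lt h, if_neg h.asymm, Finset.sum_const_zero, mul_zero]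
      · have hin : i + 1 < n := hn.inversion_lt i.lt_succ_self h
        have hr_swap : Equiv.swap i (i + 1) r < n := by
          rw [Equiv.swap_apply_def]
          split_ifs <;> omega
        have hlen := length_mul_transp_adj_of_gt h
        simp only [if_pos h]
        rw [swapDiff_schubert_of_gt h, mul_left_comm, sum_range_swap (Nat.succ_lt_succ hi)
          (monkTerm (w * transp i (i + 1)) (Equiv.swap i (i + 1) r)),
          ih _ (by omega) (hn.mul_transp hi hin) hr_swap rfl]
    · have hlt : w.1 i < w.1 (i + 1) := by
        rw [hn i hi, hn (i + 1) (by omega)]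
        exact i.lt_succ_self
      rw [swapDiff_schubert_of_lt hlt, mul_zero, swapDiff_apply, rename_X,
        Equiv.swap_apply_of_ne_of_ne (by omega) (by omega), sub_self, zero_mul, add_zero,
        Finset.sum_eq_zero fun k hk => swapDiff_monkTerm_of_ge hn hr.le
          (Nat.le_of_lt_succ (Finset.mem_range.1 hk)) hi]
  · rw [map_mul, constantCoeff_X, zero_mul, map_sum,
      Finset.sum_eq_zero fun k _ => constantCoeff_monkTerm w r k]

theorem span_range_schubert : Submodule.span ℤ (Set.range schubert) = ⊤ := by
  have hX (r : ℕ) (f : MvPolynomial ℕ ℤ) (hf : f ∈ Submodule.span ℤ (Set.range schubert)) :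
      f * X r ∈ Submodule.span ℤ (Set.range schubert) := by
    induction hf using Submodule.span_induction with
    | mem f hf =>
      obtain ⟨w, rfl⟩ := hf
      obtain ⟨n, hrn, hn⟩ := exists_fixesFrom_ge w (r + 1)
      rw [mul_comm, X_mul_schubert hn hrn]
      refine Submodule.sum_mem _ fun k _ => Submodule.sub_mem _ ?_ ?_ <;>
      · rw [coverTerm]
        split_ifs
        · exact Submodule.subset_span ⟨_, rfl⟩
        · exact Submodule.zero_mem _
    | zero => rw [zero_mul]; exact Submodule.zero_mem _
    | add f g _ _ hf hg => rw [add_mul]; exact Submodule.add_mem _ hf hg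
    | smul a f _ hf => rw [smul_mul_assoc]; exact Submodule.smul_mem _ a hf
  refine Submodule.eq_top_iff'.2 fun f => ?_
  induction f using MvPolynomial.induction_on with
  | C a =>
    rw [← mul_one (C a), ← smul_eq_C_mul]
    exact Submodule.smul_mem _ a (Submodule.subset_span ⟨1, schubert_one⟩)
  | add f g hf hg => exact Submodule.add_mem _ hf hg
  | mul_X f r hf => exact hX r f hf

theorem isSchubertExpansion_schubertExpansion (f : MvPolynomial ℕ ℤ) :
    IsSchubertExpansion f (schubertExpansion f) := by
  obtain ⟨c, hc⟩ := Finsupp.mem_span_range_iff_exists_finsupp.1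
    (span_range_schubert ▸ Submodule.mem_top : f ∈ Submodule.span ℤ (Set.range schubert))
  exact Classical.epsilon_spec (p := IsSchubertExpansion f) ⟨c, hc.symm⟩

end Monk

/-! ### Maximal transitions -/

/-- `r` is the largest descent of `x`, and `s` the largest position with `x s < x r`. -/
structure IsMaxTransition (x : SInf) (r s : ℕ) : Prop where
  desc : IsGreatest (descents x) r
  pos : IsGreatest {s | x.1 s < x.1 r} s

theorem exists_isMaxTransition {x : SInf} (hx : (descents x).Nonempty) :
    ∃ r s, IsMaxTransition x r s := by
  obtain ⟨n, -, hn⟩ := exists_fixesFrom_ge x 0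
  have hdesc : BddAbove (descents x) :=
    ⟨n, fun i hi => (Nat.lt_succ_self i).le.trans (hn.inversion_lt i.lt_succ_self hi).le⟩
  obtain ⟨r, hr⟩ := hdesc.exists_isGreatest_of_nonempty hx
  have hpos : BddAbove {s | x.1 s < x.1 r} := ⟨max r n, fun s hs => by
    by_contra! hlt
    have := hn.inversion_lt (lt_of_le_of_lt (le_max_left r n) hlt) hs
    omega⟩
  obtain ⟨s, hs⟩ := hpos.exists_isGreatest_of_nonempty ⟨r + 1, hr.1⟩
  exact ⟨r, s, hr, hs⟩

namespace IsMaxTransition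

variable {x : SInf} {r s : ℕ}

theorem lt (h : IsMaxTransition x r s) : r < s := h.pos.2 h.desc.1

theorem apply_lt (h : IsMaxTransition x r s) : x.1 s < x.1 r := h.pos.1

theorem ascendsFrom (h : IsMaxTransition x r s) : AscendsFrom (r + 1) x := fun i hi =>
  (lt_or_gt_succ x i).resolve_right fun hdesc => (h.desc.2 hdesc).not_gt hi

theorem lt_apply (h : IsMaxTransition x r s) {k : ℕ} (hk : s < k) : x.1 r < x.1 k :=
  lt_of_le_of_ne (not_lt.1 fun hlt => (h.pos.2 hlt).not_gt hk)
    (apply_ne x (h.lt.trans hk).ne)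

theorem isCover_iff (h : IsMaxTransition x r s) {k : ℕ} (hk : r < k) :
    IsCover (x * transp r s) r k ↔ k = s := by
  have hrs := h.lt
  have hsr := h.apply_lt
  refine ⟨fun ⟨_, hlt, hbetween⟩ => ?_, ?_⟩
  · by_contra hks
    rw [mul_transp_apply_left, mul_transp_apply_of_ne _ hk.ne' hks] at hlt
    rcases lt_or_gt_of_ne hks with hks | hsk
    · exact (h.ascendsFrom.strictMonoOn hk hrs hks).asymm hlt
    · have hs := hbetween s hrs hsk
      have := h.lt_apply hsk
      rw [mul_transp_apply_left, mul_transp_apply_right, mul_transp_apply_of_ne _ hk.ne' hks] at hs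
      omega
  · rintro rfl
    refine ⟨hk, ?_, fun c hrc hck => Or.inl ?_⟩
    · rwa [mul_transp_apply_left, mul_transp_apply_right]
    · rw [mul_transp_apply_left, mul_transp_apply_of_ne _ hrc.ne' hck.ne]
      exact h.ascendsFrom.strictMonoOn hrc hk hck

theorem length_eq (h : IsMaxTransition x r s) : length x = length (x * transp r s) + 1 := by
  have := ((h.isCover_iff h.lt).2 rfl).length_eq
  rwa [mul_transp_cancel] at this

theorem isMTMove_iff (h : IsMaxTransition x r s) {y : SInf} : IsMTMove x y ↔
    ∃ j, IsCover (x * transp r s) j r ∧ x * transp r s * transp j r = y := by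
  constructor
  · rintro ⟨r', s', j, hr', hs', hjr, rfl, hlen⟩
    obtain rfl := hr'.unique h.desc
    obtain rfl := hs'.unique h.pos
    exact ⟨j, isCover_of_length_eq hjr (hlen.trans h.length_eq), rfl⟩
  · rintro ⟨j, hj, rfl⟩
    exact ⟨r, s, j, h.desc, h.pos, hj.1, rfl, hj.length_eq.trans h.length_eq.symm⟩

theorem setOf_isMTMove (h : IsMaxTransition x r s) : {y | IsMTMove x y} =
    (fun j => x * transp r s * transp j r) '' {j | IsCover (x * transp r s) j r} :=
  Set.ext fun _ => h.isMTMove_iff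

theorem finite_setOf_isMTMove (h : IsMaxTransition x r s) : {y | IsMTMove x y}.Finite := by
  rw [h.setOf_isMTMove]
  exact ((Set.finite_lt_nat r).subset fun _ hj => hj.1).image _

theorem move_apply (h : IsMaxTransition x r s) {j : ℕ} (hj : j < r) (k : ℕ) :
    (x * transp r s * transp j r).1 k =
      if k = j then x.1 s else if k = r then x.1 j else if k = s then x.1 r else x.1 k := by
  have := h.lt
  simp only [mul_apply, transp_apply]
  split_ifs <;> first | rfl | omega

theorem move_apply_self (h : IsMaxTransition x r s) {j : ℕ} (hj : j < r) :
    (x * transp r s * transp j r).1 r = x.1 j := by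
  rw [h.move_apply hj, if_neg hj.ne', if_pos rfl]

theorem injOn_move (h : IsMaxTransition x r s) :
    Set.InjOn (fun j => x * transp r s * transp j r) {j | IsCover (x * transp r s) j r} := by
  intro j hj j' hj' heq
  have hval := congrArg (fun z : SInf => z.1 r) heq
  dsimp only at hval
  rwa [h.move_apply_self hj.1, h.move_apply_self hj'.1, apply_inj] at hval

open MvPolynomial in
theorem schubert_eq (h : IsMaxTransition x r s) :
    schubert x = X r * schubert (x * transp r s) + ∑ᶠ y ∈ {y | IsMTMove x y}, schubert y := by
  obtain ⟨n, hn, hfix⟩ := exists_fixesFrom_ge (x * transp r s) (s + 1)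
  have hrs := h.lt
  have hleft : ∑ k ∈ Finset.range (n + 1), coverTerm (x * transp r s) r k = schubert x := by
    rw [Finset.sum_eq_single_of_mem s (Finset.mem_range.2 (by omega)) fun k _ hks => ?_]
    · rw [coverTerm, if_pos ((h.isCover_iff hrs).2 rfl), mul_transp_cancel]
    · exact if_neg fun hcover => hks ((h.isCover_iff hcover.1).1 hcover)
  have hright : ∑ k ∈ Finset.range (n + 1), coverTerm (x * transp r s) k r =
      ∑ᶠ y ∈ {y | IsMTMove x y}, schubert y := by
    classical
    rw [h.setOf_isMTMove, finsum_mem_image h.injOn_move]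
    simp only [coverTerm, ← Finset.sum_filter]
    refine (finsum_mem_eq_sum_of_subset _ (fun j hj => ?_) fun j hj => ?_).symm
    · simp only [Finset.coe_filter, Finset.mem_range, Set.mem_ofPred_eq]
      exact ⟨by have := hj.1.1; omega, hj.1⟩
    · exact (Finset.mem_filter.1 hj).2
  rw [X_mul_schubert hfix (by omega)]
  simp only [monkTerm, Finset.sum_sub_distrib]
  rw [hleft, hright, sub_add_cancel]

end IsMaxTransition

/-- The nonempty rows of the diagram of `x` from row `N` on. -/
def rowsFrom (N : ℕ) (x : SInf) : Set ℕ := {i | N ≤ i ∧ ∃ k, i < k ∧ x.1 k < x.1 i}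

theorem finite_rowsFrom (N : ℕ) (x : SInf) : (rowsFrom N x).Finite := by
  obtain ⟨n, -, hn⟩ := exists_fixesFrom_ge x 0
  refine (Set.finite_lt_nat n).subset ?_
  rintro i ⟨-, k, hik, hinv⟩
  exact hik.trans (hn.inversion_lt hik hinv)

theorem FixesBelow.le_of_inversion {x : SInf} {K i k : ℕ} (hK : FixesBelow K x) (hik : i < k)
    (h : x.1 k < x.1 i) : K ≤ i := by
  by_contra! hi
  rw [hK i hi] at h
  rcases lt_or_ge k K with hk | hk
  · rw [hK k hk] at h
    omega
  · have := hK.le_apply hk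
    omega

theorem boxesInFirstRows_iff {N : ℕ} {x : SInf} : BoxesInFirstRows N x ↔ AscendsFrom N x := by
  constructor
  · intro h i hi
    refine (lt_or_gt_succ x i).resolve_right fun hdesc => ?_
    exact (h (i, x.1 (i + 1)) ⟨i + 1, i.lt_succ_self, hdesc, rfl⟩).not_ge hi
  · rintro h ⟨i, c⟩ ⟨k, hik, hinv, -⟩
    by_contra! hi
    exact (h.strictMonoOn hi (hi.trans hik.le) hik).asymm hinv

/-- `x` begins with at least as many fixed points as its diagram has nonempty rows from `N` on,
plus `e`.  MT-moves preserve this condition, and it guarantees that an MT-move is possible while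
the diagram has boxes outside the first `N` rows. -/
def HasRoom (N e : ℕ) (x : SInf) : Prop :=
  ∃ K ≤ N, FixesBelow K x ∧ (rowsFrom N x).ncard + e ≤ K

theorem HasRoom.fixesBelow {N e : ℕ} {x : SInf} (h : HasRoom N e x) : FixesBelow e x := by
  obtain ⟨K, -, hK, hcard⟩ := h
  exact fun i hi => hK i (by omega)

namespace IsMaxTransition

variable {x : SInf} {r s N j : ℕ}

theorem isCover_move_iff (h : IsMaxTransition x r s) : IsCover (x * transp r s) j r ↔
    j < r ∧ x.1 j < x.1 s ∧ ∀ c, j < c → c < r → x.1 c < x.1 j ∨ x.1 s < x.1 c := by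
  have hrs := h.lt
  have hof : ∀ k < r, (x * transp r s).1 k = x.1 k := fun k hk =>
    mul_transp_apply_of_ne _ hk.ne (hk.trans hrs).ne
  unfold IsCover
  rw [mul_transp_apply_left]
  refine and_congr_right fun hjr => ?_
  rw [hof j hjr]
  refine and_congr_right fun _ => forall_congr' fun c => forall₂_congr fun _ hcr => ?_
  rw [hof c hcr]

theorem ascendsFrom_move (h : IsMaxTransition x r s) (hj : j < r) :
    AscendsFrom (r + 1) (x * transp r s * transp j r) := by
  intro i hi
  have hrs := h.lt
  have hsr := h.apply_lt
  have hasc := h.ascendsFrom i hi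
  have hs := h.lt_apply s.lt_succ_self
  rw [h.move_apply hj, h.move_apply hj]
  rcases eq_or_ne i s with rfl | his
  · split_ifs <;> omega
  rcases eq_or_ne (i + 1) s with rfl | his'
  · split_ifs <;> omega
  · split_ifs <;> omega

theorem mem_rowsFrom (h : IsMaxTransition x r s) (hN : N ≤ r) : r ∈ rowsFrom N x :=
  ⟨hN, s, h.lt, h.apply_lt⟩

theorem rowsFrom_move_subset (h : IsMaxTransition x r s) (hN : N ≤ r)
    (hj : IsCover (x * transp r s) j r) :
    rowsFrom N (x * transp r s * transp j r) ⊆ insert j (rowsFrom N x) := by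
  rintro i ⟨hNi, k, hik, hk⟩
  have hrs := h.lt
  obtain ⟨hjr, hjs, hc⟩ := h.isCover_move_iff.1 hj
  rcases eq_or_ne i j with rfl | hij
  · exact Or.inl rfl
  refine Or.inr ?_
  have hir : i ≤ r := by
    by_contra! hri
    exact ((h.ascendsFrom_move hjr).strictMonoOn hri (hri.trans hik) hik).asymm hk
  rcases hir.eq_or_lt with rfl | hir
  · exact h.mem_rowsFrom hN
  refine ⟨hNi, ?_⟩
  rw [h.move_apply hjr, h.move_apply hjr, if_neg hij, if_neg hir.ne,
    if_neg (hir.trans hrs).ne] at hk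
  split_ifs at hk with hkj hkr hks
  · exact ⟨s, hir.trans hrs, hk⟩
  · rcases lt_or_gt_of_ne hij with hij | hji
    · exact ⟨j, hij, hk⟩
    · have := hc i hji hir
      exact ⟨s, hir.trans hrs, by omega⟩
  · exact ⟨r, hir, hk⟩
  · exact ⟨k, hik, hk⟩

theorem notMem_rowsFrom_move (h : IsMaxTransition x r s) (hj : j < r)
    (hrow : ∀ k, j < k → x.1 j ≤ x.1 k) : r ∉ rowsFrom N (x * transp r s * transp j r) := by
  rintro ⟨-, k, hrk, hk⟩
  rw [h.move_apply_self hj, h.move_apply hj, if_neg (hj.trans hrk).ne', if_neg hrk.ne'] at hk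
  split_ifs at hk
  · exact hk.not_ge (hrow r hj)
  · exact hk.not_ge (hrow k (hj.trans hrk))

theorem ncard_rowsFrom_move_le (h : IsMaxTransition x r s) (hN : N ≤ r)
    (hj : IsCover (x * transp r s) j r) :
    (rowsFrom N (x * transp r s * transp j r)).ncard ≤ (rowsFrom N x).ncard := by
  have hfin := finite_rowsFrom N x
  have hsub := h.rowsFrom_move_subset hN hj
  by_cases hrow : ∀ k, j < k → x.1 j ≤ x.1 k
  · have hsub' : rowsFrom N (x * transp r s * transp j r) ⊆ insert j (rowsFrom N x \ {r}) :=
      fun i hi => (hsub hi).imp_right fun hi' =>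
        ⟨hi', fun hir => h.notMem_rowsFrom_move hj.1 hrow (hir ▸ hi)⟩
    calc (rowsFrom N (x * transp r s * transp j r)).ncard
        ≤ (insert j (rowsFrom N x \ {r})).ncard := Set.ncard_le_ncard hsub' (hfin.sdiff.insert j)
      _ ≤ (rowsFrom N x \ {r}).ncard + 1 := Set.ncard_insert_le _ _
      _ = (rowsFrom N x).ncard := Set.ncard_sdiff_singleton_add_one (h.mem_rowsFrom hN) hfin
  · push Not at hrow
    obtain ⟨k, hjk, hk⟩ := hrow
    refine Set.ncard_le_ncard (fun i hi => ?_) hfin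
    rcases hsub hi with rfl | hi'
    · exact ⟨hi.1, k, hjk, hk⟩
    · exact hi'

theorem ncard_rowsFrom_move_lt (h : IsMaxTransition x r s) (hN : N ≤ r)
    (hj : IsCover (x * transp r s) j r) (hjN : j < N) (hrow : ∀ k, j < k → x.1 j ≤ x.1 k) :
    (rowsFrom N (x * transp r s * transp j r)).ncard < (rowsFrom N x).ncard := by
  refine Set.ncard_lt_ncard ⟨fun i hi => ?_, fun hsub => ?_⟩ (finite_rowsFrom N x)
  · exact (h.rowsFrom_move_subset hN hj hi).resolve_left fun hij => (hij ▸ hi.1).not_gt hjN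
  · exact h.notMem_rowsFrom_move hj.1 hrow (hsub (h.mem_rowsFrom hN))

theorem fixesBelow_move (h : IsMaxTransition x r s) {K : ℕ} (hK : FixesBelow K x) (hKj : K ≤ j)
    (hj : j < r) : FixesBelow K (x * transp r s * transp j r) :=
  (hK.mul_transp (hKj.trans hj.le) (hKj.trans (hj.trans h.lt).le)).mul_transp hKj
    (hKj.trans hj.le)

theorem hasRoom_move (h : IsMaxTransition x r s) {e : ℕ} (hN : N ≤ r)
    (hj : IsCover (x * transp r s) j r) (hx : HasRoom N e x) :
    HasRoom N e (x * transp r s * transp j r) := by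
  obtain ⟨K, hKN, hK, hcard⟩ := hx
  obtain ⟨hjr, -, hc⟩ := h.isCover_move_iff.1 hj
  rcases lt_or_ge j K with hjK | hKj
  · have hrow : ∀ k, j < k → x.1 j ≤ x.1 k := fun k hjk => by
      by_contra! hinv
      exact (hK.le_of_inversion hjk hinv).not_gt hjK
    have hlast : K - 1 ≤ j := by
      by_contra! hlt
      have hbetween := hc (K - 1) hlt (by omega)
      rw [hK j hjK, hK (K - 1) (by omega)] at hbetween
      have := hK.le_apply (i := s) (by have := h.lt; omega)
      omega
    have := h.ncard_rowsFrom_move_lt hN hj (hjK.trans_le hKN) hrow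
    exact ⟨K - 1, by omega, h.fixesBelow_move (fun i hi => hK i (by omega)) hlast hjr, by omega⟩
  · have := h.ncard_rowsFrom_move_le hN hj
    exact ⟨K, hKN, h.fixesBelow_move hK hKj hjr, by omega⟩

theorem hasRoom_of_isMTMove (h : IsMaxTransition x r s) {e : ℕ} (hN : N ≤ r) (hx : HasRoom N e x)
    {y : SInf} (hy : IsMTMove x y) : HasRoom N e y := by
  obtain ⟨j, hj, rfl⟩ := h.isMTMove_iff.1 hy
  exact h.hasRoom_move hN hj hx

theorem exists_isMTMove (h : IsMaxTransition x r s) {e : ℕ} (hN : N ≤ r) (hx : HasRoom N e x) :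
    ∃ y, IsMTMove x y := by
  obtain ⟨K, hKN, hK, hcard⟩ := hx
  have hrs := h.lt
  have hpos : 0 < (rowsFrom N x).ncard :=
    (Set.ncard_pos (finite_rowsFrom N x)).2 ⟨r, h.mem_rowsFrom hN⟩
  have hzero : x.1 0 < x.1 s := by
    have := hK.le_apply (i := s) (by omega)
    rw [hK 0 (by omega)]
    omega
  obtain ⟨j, hj, hmax⟩ := Set.exists_max_image {j | j < r ∧ x.1 j < x.1 s} x.1
    ((Set.finite_lt_nat r).subset fun _ hj => hj.1) ⟨0, by omega, hzero⟩
  refine ⟨_, h.isMTMove_iff.2 ⟨j, h.isCover_move_iff.2 ⟨hj.1, hj.2, fun c hjc hcr => ?_⟩, rfl⟩⟩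
  refine (lt_or_gt_of_ne (apply_ne x (hcr.trans hrs).ne)).imp_left fun hcs => ?_
  exact lt_of_le_of_ne (hmax c ⟨hcr, hcs⟩) (apply_ne x hjc.ne')

end IsMaxTransition

theorem mtMove_induction {N : ℕ} {P : SInf → Prop} (hbox : ∀ x, BoxesInFirstRows N x → P x)
    (hmove : ∀ x r s, IsMaxTransition x r s → N ≤ r → (∀ y, IsMTMove x y → P y) → P x)
    (x : SInf) : P x := by
  obtain ⟨R, -, hfix⟩ := exists_fixesFrom_ge x 0
  have hR : AscendsFrom R x := fun i hi => by
    rw [hfix i hi, hfix (i + 1) (by omega)]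
    omega
  clear hfix
  -- A move lowers the value at the last descent `r` and creates no descent beyond `r`.
  induction R generalizing x with
  | zero => exact hbox x (boxesInFirstRows_iff.2 fun i _ => hR i i.zero_le)
  | succ r ihr =>
    induction hb : x.1 r using Nat.strong_induction_on generalizing x with
    | _ b ihb =>
    have hsucc (hasc : x.1 r < x.1 (r + 1)) : AscendsFrom r x := fun i hi =>
      hi.eq_or_lt.elim (fun h => h ▸ hasc) (hR i)
    rcases lt_or_gt_succ x r with hasc | hdesc
    · exact ihr x (hsucc hasc)
    by_cases hN : N ≤ r
    · have hgreatest : IsGreatest (descents x) r :=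
        ⟨hdesc, fun i hi => not_lt.1 fun hri => (hR i hri).asymm hi⟩
      obtain ⟨r', s, h⟩ := exists_isMaxTransition ⟨r, hdesc⟩
      obtain rfl := h.desc.unique hgreatest
      refine hmove x r' s h hN fun y hy => ?_
      obtain ⟨j, hj, rfl⟩ := h.isMTMove_iff.1 hy
      have hlt : x.1 j < b := hb ▸ (h.isCover_move_iff.1 hj).2.1.trans h.apply_lt
      exact ihb (x.1 j) hlt _ (h.ascendsFrom_move hj.1) (h.move_apply_self hj.1)
    · exact hbox x (boxesInFirstRows_iff.2 fun i hi => hR i (by omega))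

/-! ### Runs of MT-moves -/

/-- The complete runs of MT-moves from `x`. -/
def mtRuns (N : ℕ) (x : SInf) : Set (List SInf) := {l | ∃ y, IsMTRun N x y l}

/-- The last element of a run; the default value `1` is only taken at the empty list, which is
not a run. -/
def runEnd (l : List SInf) : SInf := l.getLast?.getD 1

theorem IsMTRun.runEnd_eq {N : ℕ} {x y : SInf} {l : List SInf} (h : IsMTRun N x y l) :
    runEnd l = y := by
  rw [runEnd, h.last, Option.getD_some]

theorem IsMaxTransition.not_boxesInFirstRows {x : SInf} {r s N : ℕ} (h : IsMaxTransition x r s)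
    (hN : N ≤ r) : ¬ BoxesInFirstRows N x := fun hbox =>
  (boxesInFirstRows_iff.1 hbox r hN).asymm h.desc.1

theorem isMTRun_singleton {N : ℕ} {x y z : SInf} :
    IsMTRun N x y [z] ↔ z = x ∧ z = y ∧ (BoxesInFirstRows N y ∨ ∀ a, ¬ IsMTMove y a) :=
  ⟨fun h => ⟨Option.some.inj h.head, Option.some.inj h.last, h.final⟩,
    fun ⟨hx, hy, hfinal⟩ => ⟨congrArg some hx, congrArg some hy, .singleton _, hfinal⟩⟩

theorem isMTRun_cons_cons {N : ℕ} {x y z a : SInf} {l : List SInf} :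
    IsMTRun N x y (z :: a :: l) ↔
      z = x ∧ ¬ BoxesInFirstRows N x ∧ IsMTMove x a ∧ IsMTRun N a y (a :: l) := by
  constructor
  · rintro ⟨hhead, hlast, hchain, hfinal⟩
    obtain rfl := Option.some.inj hhead
    obtain ⟨⟨hbox, hmove⟩, hchain⟩ := List.isChain_cons_cons.1 hchain
    exact ⟨rfl, hbox, hmove, rfl, List.getLast?_cons_cons.symm.trans hlast, hchain, hfinal⟩
  · rintro ⟨rfl, hbox, hmove, -, hlast, hchain, hfinal⟩
    exact ⟨rfl, List.getLast?_cons_cons.trans hlast,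
      List.isChain_cons_cons.2 ⟨⟨hbox, hmove⟩, hchain⟩, hfinal⟩

theorem not_isMTRun_nil {N : ℕ} {x y : SInf} : ¬ IsMTRun N x y [] := fun h =>
  nomatch h.head

theorem mtRuns_eq_singleton {N : ℕ} {x : SInf}
    (hx : BoxesInFirstRows N x ∨ ∀ z, ¬ IsMTMove x z) : mtRuns N x = {[x]} := by
  ext l
  constructor
  · rintro ⟨y, hy⟩
    match l, hy with
    | [], hy => exact (not_isMTRun_nil hy).elim
    | [z], hy => rw [(isMTRun_singleton.1 hy).1]; rfl
    | z :: a :: l, hy =>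
      obtain ⟨-, hbox, hmove, -⟩ := isMTRun_cons_cons.1 hy
      exact (hx.elim hbox fun h => h a hmove).elim
  · rintro rfl
    exact ⟨x, isMTRun_singleton.2 ⟨rfl, rfl, hx⟩⟩

theorem mtRuns_eq_iUnion {N : ℕ} {x : SInf} (hbox : ¬ BoxesInFirstRows N x)
    (hmove : ∃ z, IsMTMove x z) :
    mtRuns N x = ⋃ y ∈ {y | IsMTMove x y}, List.cons x '' mtRuns N y := by
  ext l
  simp only [Set.mem_iUnion₂, Set.mem_image]
  constructor
  · rintro ⟨y, hy⟩
    match l, hy with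
    | [], hy => exact (not_isMTRun_nil hy).elim
    | [z], hy =>
      obtain ⟨rfl, rfl, hfinal⟩ := isMTRun_singleton.1 hy
      exact (hfinal.elim hbox fun h => hmove.elim h).elim
    | z :: a :: l, hy =>
      obtain ⟨rfl, -, ha, hrun⟩ := isMTRun_cons_cons.1 hy
      exact ⟨a, ha, a :: l, ⟨y, hrun⟩, rfl⟩
  · rintro ⟨a, ha, l, ⟨y, hrun⟩, rfl⟩
    match l, hrun with
    | [], hrun => exact (not_isMTRun_nil hrun).elim
    | b :: l, hrun =>
      obtain rfl := Option.some.inj hrun.head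
      exact ⟨y, isMTRun_cons_cons.2 ⟨rfl, hbox, ha, hrun⟩⟩

theorem runEnd_cons {N : ℕ} {x y : SInf} {l : List SInf} (hl : l ∈ mtRuns N y) :
    runEnd (x :: l) = runEnd l := by
  match l, hl with
  | [], ⟨_, h⟩ => exact (not_isMTRun_nil h).elim
  | a :: l, _ => rw [runEnd, List.getLast?_cons_cons, runEnd]

theorem pairwiseDisjoint_cons_mtRuns (N : ℕ) (x : SInf) (S : Set SInf) :
    S.PairwiseDisjoint fun y => List.cons x '' mtRuns N y := by
  intro y _ y' _ hne
  refine Set.disjoint_left.2 ?_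
  rintro _ ⟨l, ⟨z, hz⟩, rfl⟩ ⟨l', ⟨z', hz'⟩, hl'⟩
  obtain rfl := List.cons_injective hl'
  exact hne (Option.some.inj (hz.head.symm.trans hz'.head))

theorem finite_mtRuns (N : ℕ) (x : SInf) : (mtRuns N x).Finite := by
  induction x using mtMove_induction (N := N) with
  | hbox x hx =>
    rw [mtRuns_eq_singleton (Or.inl hx)]
    exact Set.finite_singleton _
  | hmove x r s h hN ih =>
    by_cases hmove : ∃ z, IsMTMove x z
    · rw [mtRuns_eq_iUnion (h.not_boxesInFirstRows hN) hmove]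
      exact h.finite_setOf_isMTMove.biUnion fun y hy => (ih y hy).image _
    · rw [mtRuns_eq_singleton (Or.inr (not_exists.1 hmove))]
      exact Set.finite_singleton _

theorem HasRoom.fixesBelow_runEnd {N e : ℕ} {x : SInf} (hx : HasRoom N e x) {l : List SInf}
    (hl : l ∈ mtRuns N x) : FixesBelow e (runEnd l) := by
  induction x using mtMove_induction (N := N) generalizing l with
  | hbox x hbox =>
    rw [mtRuns_eq_singleton (Or.inl hbox)] at hl
    obtain rfl := hl
    exact hx.fixesBelow
  | hmove x r s h hN ih =>
    rw [mtRuns_eq_iUnion (h.not_boxesInFirstRows hN) (h.exists_isMTMove hN hx)] at hl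
    obtain ⟨y, hy, l', hl', rfl⟩ := Set.mem_iUnion₂.1 hl
    rw [runEnd_cons hl']
    exact ih y hy (h.hasRoom_of_isMTMove hN hx hy) hl'

open MvPolynomial in
theorem HasRoom.trunc_schubert {N e : ℕ} {x : SInf} (hx : HasRoom N e x) :
    trunc N (schubert x) = ∑ᶠ l ∈ mtRuns N x, schubert (runEnd l) := by
  induction x using mtMove_induction (N := N) with
  | hbox x hbox =>
    rw [mtRuns_eq_singleton (Or.inl hbox), finsum_mem_singleton]
    exact (boxesInFirstRows_iff.1 hbox).trunc_schubert
  | hmove x r s h hN ih =>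
    have hfin := h.finite_setOf_isMTMove
    calc trunc N (schubert x)
        = ∑ᶠ y ∈ {y | IsMTMove x y}, trunc N (schubert y) := by
          rw [h.schubert_eq, map_add, map_mul, trunc_X, if_neg hN.not_gt, zero_mul, zero_add]
          exact (trunc N).toAddMonoidHom.map_finsum_mem _ hfin
      _ = ∑ᶠ y ∈ {y | IsMTMove x y}, ∑ᶠ l ∈ List.cons x '' mtRuns N y, schubert (runEnd l) :=
          finsum_mem_congr rfl fun y hy => by
            rw [ih y hy (h.hasRoom_of_isMTMove hN hx hy),
              finsum_mem_image List.cons_injective.injOn]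
            exact finsum_mem_congr rfl fun l hl => by rw [runEnd_cons hl]
      _ = ∑ᶠ l ∈ mtRuns N x, schubert (runEnd l) := by
          rw [mtRuns_eq_iUnion (h.not_boxesInFirstRows hN) (h.exists_isMTMove hN hx)]
          exact (finsum_mem_biUnion (pairwiseDisjoint_cons_mtRuns N x _) hfin
            fun y _ => (finite_mtRuns N y).image _).symm

/-- The number of complete runs of MT-moves from `x` with a given end, as a function of the end. -/
noncomputable def runCount (N : ℕ) (x : SInf) : SInf →₀ ℤ :=
  ∑ᶠ l ∈ mtRuns N x, Finsupp.single (runEnd l) 1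

theorem HasRoom.isSchubertExpansion_runCount {N e : ℕ} {x : SInf} (hx : HasRoom N e x) :
    IsSchubertExpansion (trunc N (schubert x)) (runCount N x) := by
  have hsum := (Finsupp.linearCombination ℤ schubert).toAddMonoidHom.map_finsum_mem
    (fun l => Finsupp.single (runEnd l) 1) (finite_mtRuns N x)
  simp only [LinearMap.toAddMonoidHom_coe, Finsupp.linearCombination_single, one_smul] at hsum
  exact hx.trunc_schubert.trans hsum.symm

theorem runCount_apply (N : ℕ) (x v : SInf) :
    runCount N x v = ({l ∈ mtRuns N x | runEnd l = v}.ncard : ℤ) := by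
  classical
  rw [runCount, finsum_mem_eq_finite_toFinset_sum _ (finite_mtRuns N x), Finsupp.finsetSum_apply]
  simp only [Finsupp.single_apply]
  rw [Finset.sum_boole, Nat.cast_inj, ← Set.ncard_coe_finset]
  congr 1
  ext l
  simp

/-! ### The diagram determines the permutation -/

theorem not_lt_of_diagram_eq {x y : SInf} (h : diagram x = diagram y) {i : ℕ}
    (hi : ∀ k, k < i → x.1 k = y.1 k) : ¬ x.1 i < y.1 i := by
  intro hlt
  obtain ⟨k, hk⟩ := y.1.surjective (x.1 i)
  have hik : i < k := by
    by_contra! hki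
    rcases hki.eq_or_lt with rfl | hki
    · exact hlt.ne' hk
    · rw [← hi k hki, apply_inj] at hk
      exact hki.ne hk
  obtain ⟨k', hik', -, hk'⟩ : (i, x.1 i) ∈ diagram x := h ▸ ⟨k, hik, hk.trans_lt hlt, hk.symm⟩
  exact hik'.ne ((apply_inj x).1 hk')

theorem diagram_injective : Function.Injective diagram := by
  intro x y h
  ext i
  induction i using Nat.strong_induction_on with
  | _ i ih =>
    exact le_antisymm (not_lt.1 (not_lt_of_diagram_eq h.symm fun k hk => (ih k hk).symm))
      (not_lt.1 (not_lt_of_diagram_eq h ih))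

theorem mtRunsTo_subset (N : ℕ) (x : SInf) (D : Set (ℕ × ℕ)) : mtRunsTo N x D ⊆ mtRuns N x :=
  fun _ ⟨y, hy, _⟩ => ⟨y, hy⟩

theorem finite_mtRunsTo (N : ℕ) (x : SInf) (D : Set (ℕ × ℕ)) : (mtRunsTo N x D).Finite :=
  (finite_mtRuns N x).subset (mtRunsTo_subset N x D)

theorem mtRunsTo_diagram (N : ℕ) (x v : SInf) :
    mtRunsTo N x (diagram v) = {l ∈ mtRuns N x | runEnd l = v} := by
  ext l
  constructor
  · rintro ⟨y, hy, hD⟩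
    exact ⟨⟨y, hy⟩, hy.runEnd_eq.trans (diagram_injective hD)⟩
  · rintro ⟨⟨y, hy⟩, rfl⟩
    exact ⟨y, hy, by rw [hy.runEnd_eq]⟩

/-! ### The code -/

theorem code_ne_zero_iff {x : SInf} {i : ℕ} : code x i ≠ 0 ↔ ∃ k, i < k ∧ x.1 k < x.1 i := by
  obtain ⟨n, -, hn⟩ := exists_fixesFrom_ge x 0
  have hfin : {j | i < j ∧ x.1 j < x.1 i}.Finite :=
    (Set.finite_lt_nat n).subset fun j hj => hn.inversion_lt hj.1 hj.2
  rw [code, ← Nat.pos_iff_ne_zero, Set.ncard_pos hfin]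
  rfl

theorem codeLength_le_iff {x : SInf} {n : ℕ} : codeLength x ≤ n ↔ AscendsFrom n x := by
  obtain ⟨N, -, hN⟩ := exists_fixesFrom_ge x 0
  have hbdd : BddAbove {k | ∃ i, k = i + 1 ∧ code x i ≠ 0} := by
    refine ⟨N, ?_⟩
    rintro _ ⟨i, rfl, hi⟩
    obtain ⟨k, hik, hinv⟩ := code_ne_zero_iff.1 hi
    exact hik.trans (hN.inversion_lt hik hinv)
  constructor
  · intro h i hi
    refine (lt_or_gt_succ x i).resolve_right fun hdesc => ?_
    have hcode : i < codeLength x :=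
      le_csSup hbdd ⟨i, rfl, code_ne_zero_iff.2 ⟨i + 1, i.lt_succ_self, hdesc⟩⟩
    omega
  · intro h
    refine csSup_le' ?_
    rintro _ ⟨i, rfl, hi⟩
    obtain ⟨k, hik, hinv⟩ := code_ne_zero_iff.1 hi
    by_contra! hni
    exact (h.strictMonoOn (Nat.le_of_lt_succ hni)
      ((Nat.le_of_lt_succ hni).trans hik.le) hik).asymm hinv

theorem IsGrassmannian.succ_eq_codeLength {x : SInf} (hx : IsGrassmannian x) {i : ℕ}
    (hi : i ∈ descents x) : i + 1 = codeLength x := by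
  refine le_antisymm ?_ (codeLength_le_iff.2 fun k hk => ?_)
  · by_contra! hlt
    exact (codeLength_le_iff.1 (Nat.le_of_lt_succ hlt) i le_rfl).asymm hi
  · exact (lt_or_gt_succ x k).resolve_right fun hdesc => by
      have := hx hdesc hi
      omega

theorem ncard_rowsFrom_zero_le_length (x : SInf) : (rowsFrom 0 x).ncard ≤ length x := by
  have hsub : rowsFrom 0 x ⊆ Prod.fst '' inversions x := by
    rintro i ⟨-, k, hik, hinv⟩
    exact ⟨(i, k), ⟨hik, hinv⟩, rfl⟩
  exact (Set.ncard_le_ncard hsub ((finite_inversions x).image _)).trans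
    (Set.ncard_image_le (finite_inversions x))

theorem AscendsFrom.ncard_rowsFrom_zero_le {x : SInf} {n : ℕ} (h : AscendsFrom n x) :
    (rowsFrom 0 x).ncard ≤ n := by
  have hsub : rowsFrom 0 x ⊆ Finset.range n := by
    rintro i ⟨-, k, hik, hinv⟩
    by_contra hni
    rw [Finset.coe_range, Set.mem_Iio, not_lt] at hni
    exact (h.strictMonoOn hni (hni.trans hik.le) hik).asymm hinv
  simpa using Set.ncard_le_ncard hsub (Finset.finite_toSet _)

/-! ### The permutation `1ⁿ × w × u` -/

theorem fixesFrom_ofFin {p : ℕ} (w : Equiv.Perm (Fin p)) : FixesFrom p (ofFin w) := fun i hi => by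
  rw [ofFin, directSum_apply_ge w 1 hi, one_apply, Nat.add_sub_cancel' hi]

theorem ofFin_apply_of_lt {p : ℕ} (w : Equiv.Perm (Fin p)) (v : SInf) {i : ℕ} (hi : i < p) :
    (ofFin w).1 i = (directSum w v).1 i := by
  rw [ofFin, directSum_apply_lt w _ hi, directSum_apply_lt w _ hi]

theorem directSum_eq_mul {p : ℕ} (w : Equiv.Perm (Fin p)) (v : SInf) :
    directSum w v = ofFin w * ones p v := by
  ext i
  rw [mul_apply, ones_apply]
  split_ifs with h
  · exact (ofFin_apply_of_lt w v h).symm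
  · rw [not_lt] at h
    rw [directSum_apply_ge w v h, fixesFrom_ofFin w _ (Nat.le_add_right p _)]

theorem ones_mul (n : ℕ) (a b : SInf) : ones n (a * b) = ones n a * ones n b := by
  ext i
  rw [mul_apply]
  rcases lt_or_ge i n with h | h
  · rw [fixesBelow_ones n _ i h, fixesBelow_ones n _ i h, fixesBelow_ones n _ i h]
  · obtain ⟨k, rfl⟩ := Nat.exists_eq_add_of_le h
    rw [ones_apply_add, ones_apply_add, ones_apply_add, mul_apply]

section DirectSum

variable {p : ℕ} (w : Equiv.Perm (Fin p)) {u : SInf} {m : ℕ}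

theorem schubert_ones_directSum (v : SInf) (n : ℕ) : schubert (ones n (directSum w v)) =
    schubert (ones n (ofFin w)) * schubert (ones (n + p) v) := by
  rw [directSum_eq_mul, ones_mul, ones_ones]
  refine schubert_mul (p := n + p) (fun i hi => ?_) (fixesBelow_ones _ v)
  obtain ⟨k, rfl⟩ := Nat.exists_eq_add_of_le ((Nat.le_add_right n p).trans hi)
  rw [ones_apply_add, fixesFrom_ofFin w k (by omega)]

theorem trunc_schubert_ones_directSum (hw : AscendsFrom m (ofFin w)) (hu : AscendsFrom m u)
    (hG : AscendsBelow m u) (n : ℕ) : trunc (n + m) (schubert (ones n (directSum w u))) =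
      schubert (ones n (ofFin w)) * schubert (ones n u) := by
  rw [schubert_ones_directSum, map_mul, (hw.ones n).trunc_schubert, add_comm n p,
    ← ones_ones p n, trunc_schubert_ones (hG.ones n), (hu.ones n).trunc_schubert]

theorem rowsFrom_ones_directSum (hw : AscendsFrom m (ofFin w)) (u : SInf) (n : ℕ) :
    rowsFrom (n + m) (ones n (directSum w u)) ⊆ (fun i => n + p + i) '' rowsFrom 0 u := by
  rintro i ⟨hi, k, hik, hk⟩
  obtain ⟨a, rfl⟩ := Nat.exists_eq_add_of_le ((Nat.le_add_right n m).trans hi)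
  obtain ⟨b, rfl⟩ := Nat.exists_eq_add_of_le ((Nat.le_add_right n a).trans hik.le)
  rw [ones_apply_add_lt_iff] at hk
  rw [Nat.add_lt_add_iff_left] at hik
  rw [Nat.add_le_add_iff_left] at hi
  rcases lt_or_ge a p with ha | ha
  · refine absurd hk (lt_asymm ?_)
    rcases lt_or_ge b p with hb | hb
    · rw [← ofFin_apply_of_lt w u ha, ← ofFin_apply_of_lt w u hb]
      exact hw.strictMonoOn hi (hi.trans hik.le) hik
    · rw [← ofFin_apply_of_lt w u ha, directSum_apply_ge w u hb]
      exact ((fixesFrom_ofFin w).apply_lt ha).trans_le (Nat.le_add_right p _)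
  · rw [directSum_apply_ge w u ha, directSum_apply_ge w u (ha.trans hik.le),
      Nat.add_lt_add_iff_left] at hk
    exact ⟨a - p, ⟨Nat.zero_le _, b - p, by omega, hk⟩, by dsimp only; omega⟩

theorem hasRoom_ones_directSum (hw : AscendsFrom m (ofFin w)) {n : ℕ}
    (hn : (rowsFrom 0 u).ncard ≤ n) :
    HasRoom (n + m) (n - (rowsFrom 0 u).ncard) (ones n (directSum w u)) := by
  have hfin := finite_rowsFrom 0 u
  have hcard : (rowsFrom (n + m) (ones n (directSum w u))).ncard ≤ (rowsFrom 0 u).ncard :=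
    (Set.ncard_le_ncard (rowsFrom_ones_directSum w hw u n) (hfin.image _)).trans
      (Set.ncard_image_le hfin)
  exact ⟨n, Nat.le_add_right n m, fixesBelow_ones n _, by omega⟩

end DirectSum

/-! ### The canonical expansion -/

theorem IsSchubertExpansion.delVar_zero {f : MvPolynomial ℕ ℤ} {c : SInf →₀ ℤ}
    (h : IsSchubertExpansion f c) :
    IsSchubertExpansion (delVar 0 f) (c.comapDomain (ones 1) (ones_injective 1).injOn) := by
  rw [IsSchubertExpansion, h, Finsupp.sum, Finsupp.sum, map_sum]
  simp only [Finsupp.comapDomain_apply, Finsupp.comapDomain_support, map_zsmul]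
  rw [← Finset.sum_preimage (ones 1) c.support (ones_injective 1).injOn
    (fun v => c v • delVar 0 (schubert v))]
  · simp only [delVar_zero_schubert_ones]
  · intro v _ hv
    have hv0 : v.1 0 ≠ 0 := fun hv0 => hv <| by
      obtain ⟨v', rfl⟩ := FixesBelow.exists_eq_ones (n := 1) (z := v) fun i hi => by
        rwa [Nat.lt_one_iff.1 hi]
      exact ⟨v', rfl⟩
    rw [delVar_zero_schubert_of_ne hv0, smul_zero]

theorem delVar_zero_schubert_mul (w u : SInf) (n : ℕ) :
    delVar 0 (schubert (ones (n + 1) w) * schubert (ones (n + 1) u)) =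
      schubert (ones n w) * schubert (ones n u) := by
  rw [map_mul, add_comm n 1, ← ones_ones, ← ones_ones, delVar_zero_schubert_ones,
    delVar_zero_schubert_ones]

theorem prodCoeff_succ_ones_one (w u : SInf) (n : ℕ) (v : SInf) :
    prodCoeff w u (n + 1) (ones 1 v) = prodCoeff w u n v := by
  have h := (isSchubertExpansion_schubertExpansion
    (schubert (ones (n + 1) w) * schubert (ones (n + 1) u))).delVar_zero
  rw [delVar_zero_schubert_mul] at h
  rw [prodCoeff, prodCoeff, h.schubertExpansion_eq, Finsupp.comapDomain_apply]

theorem prodCoeff_add_ones (w u : SInf) (n d : ℕ) (v : SInf) :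
    prodCoeff w u (n + d) (ones d v) = prodCoeff w u n v := by
  induction d with
  | zero => rw [ones_zero, add_zero]
  | succ d ih => rw [← add_assoc, add_comm d 1, ← ones_ones, prodCoeff_succ_ones_one, ih]

theorem mem_newTerms_zero {w u v : SInf} : v ∈ newTerms w u 0 ↔ prodCoeff w u 0 v ≠ 0 :=
  Finsupp.mem_support_iff

theorem mem_newTerms_succ {w u v : SInf} {n : ℕ} :
    v ∈ newTerms w u (n + 1) ↔ prodCoeff w u (n + 1) v ≠ 0 ∧ v ∉ Set.range (ones 1) := by
  simp only [newTerms, Finset.mem_filter, Finsupp.mem_support_iff]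
  refine and_congr_right fun hv => ⟨?_, fun h v' _ hv' => h ⟨v', hv'.symm⟩⟩
  rintro h ⟨v', rfl⟩
  rw [prodCoeff_succ_ones_one] at hv
  exact h v' hv rfl

theorem exists_mem_newTerms {w u y : SInf} {n : ℕ} (hy : prodCoeff w u n y ≠ 0) :
    ∃ i ≤ n, ∃ v ∈ newTerms w u i, y = ones (n - i) v := by
  induction n generalizing y with
  | zero => exact ⟨0, le_rfl, y, mem_newTerms_zero.2 hy, (ones_zero y).symm⟩
  | succ n ih =>
    by_cases hrange : y ∈ Set.range (ones 1)
    · obtain ⟨y, rfl⟩ := hrange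
      rw [prodCoeff_succ_ones_one] at hy
      obtain ⟨i, hi, v, hv, rfl⟩ := ih hy
      refine ⟨i, hi.trans n.le_succ, v, hv, ?_⟩
      rw [ones_ones, add_comm, Nat.sub_add_comm hi]
    · refine ⟨n + 1, le_rfl, y, mem_newTerms_succ.2 ⟨hy, hrange⟩, ?_⟩
      rw [Nat.sub_self, ones_zero]

theorem prodCoeff_succ (w u : SInf) (n : ℕ) : prodCoeff w u (n + 1) =
    (prodCoeff w u n).mapDomain (ones 1) +
      ∑ v ∈ newTerms w u (n + 1), Finsupp.single v (prodCoeff w u (n + 1) v) := by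
  classical
  ext v
  rw [Finsupp.add_apply, Finsupp.finsetSum_apply]
  simp only [Finsupp.single_apply, Finset.sum_ite_eq', mem_newTerms_succ]
  by_cases hrange : v ∈ Set.range (ones 1)
  · rw [if_neg fun h => h.2 hrange, add_zero]
    obtain ⟨v, rfl⟩ := hrange
    rw [prodCoeff_succ_ones_one, Finsupp.mapDomain_apply (ones_injective 1)]
  · rw [Finsupp.mapDomain_of_notMem_range _ v hrange, zero_add]
    split_ifs with h
    · rfl
    · exact not_not.1 fun hne => h ⟨hne, hrange⟩

theorem prodCoeff_eq_sum (w u : SInf) (n : ℕ) : prodCoeff w u n = ∑ i ∈ Finset.range (n + 1),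
    ∑ v ∈ newTerms w u i, Finsupp.single (ones (n - i) v) (prodCoeff w u i v) := by
  induction n with
  | zero =>
    simp only [zero_add, Finset.sum_range_one, Nat.sub_self, ones_zero]
    exact (Finsupp.sum_single _).symm
  | succ n ih =>
    rw [prodCoeff_succ, Finset.sum_range_succ, Nat.sub_self, ih, Finsupp.mapDomain_finsetSum]
    simp only [Finsupp.mapDomain_finsetSum, Finsupp.mapDomain_single, ones_ones, ones_zero]
    congr 1
    refine Finset.sum_congr rfl fun i hi => ?_
    rw [add_comm 1, ← Nat.sub_add_comm (Nat.le_of_lt_succ (Finset.mem_range.1 hi))]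

theorem schubert_mul_eq_sum (w u : SInf) (n : ℕ) :
    schubert (ones n w) * schubert (ones n u) = ∑ i ∈ Finset.range (n + 1),
      ∑ v ∈ newTerms w u i, prodCoeff w u i v • schubert (ones (n - i) v) := by
  have h : _ = Finsupp.linearCombination ℤ schubert (prodCoeff w u n) :=
    isSchubertExpansion_schubertExpansion (schubert (ones n w) * schubert (ones n u))
  rw [h, prodCoeff_eq_sum]
  simp only [map_sum, Finsupp.linearCombination_single]

/-! ### Stanley symmetric functions -/

theorem coeff_stanley (v : SInf) {e : ℕ →₀ ℕ} {d n : ℕ} (he : ∀ i ∈ e.support, i < d)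
    (hn : d ≤ n) :
    MvPowerSeries.coeff e (stanley v) = MvPolynomial.coeff e (schubert (ones n v)) := by
  have hstable (n : ℕ) (hn : d ≤ n) : MvPolynomial.coeff e (schubert (ones n v)) =
      MvPolynomial.coeff e (schubert (ones d v)) := by
    obtain ⟨p, rfl⟩ := Nat.exists_eq_add_of_le' hn
    have hasc : AscendsBelow d (ones d v) := fun i hi => by
      rw [fixesBelow_ones d v i (by omega), fixesBelow_ones d v _ hi]
      exact i.lt_succ_self
    rw [← coeff_trunc _ he, ← ones_ones, trunc_schubert_ones hasc, coeff_trunc _ he]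
  rw [hstable n hn]
  exact (tendsto_atTop_of_eventually_const hstable).limUnder_eq

theorem coeff_stanley_mul (w u : SInf) {e : ℕ →₀ ℕ} {d n : ℕ} (he : ∀ i ∈ e.support, i < d)
    (hn : d ≤ n) : MvPowerSeries.coeff e (stanley w * stanley u) =
      MvPolynomial.coeff e (schubert (ones n w) * schubert (ones n u)) := by
  classical
  rw [MvPowerSeries.coeff_mul, MvPolynomial.coeff_mul]
  refine Finset.sum_congr rfl fun a ha => ?_
  rw [Finset.HasAntidiagonal.mem_antidiagonal] at ha
  have hfst : a.1.support ⊆ e.support := Finsupp.support_mono (ha ▸ le_self_add)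
  have hsnd : a.2.support ⊆ e.support := Finsupp.support_mono (ha ▸ le_add_self)
  rw [coeff_stanley w (fun i hi => he i (hfst hi)) hn,
    coeff_stanley u (fun i hi => he i (hsnd hi)) hn]

theorem stanley_mul_eq_sum {w u : SInf} {k : ℕ} (hk : ∀ i, k < i → newTerms w u i = ∅) :
    stanley w * stanley u = ∑ i ∈ Finset.range (k + 1),
      ∑ v ∈ newTerms w u i, prodCoeff w u i v • stanley v := by
  ext e
  obtain ⟨b, hb⟩ := e.support.bddAbove
  have he : ∀ i ∈ e.support, i < b + 1 := fun i hi => Nat.lt_succ_of_le (hb hi)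
  rw [coeff_stanley_mul w u he (n := b + 1 + k) (Nat.le_add_right _ k), schubert_mul_eq_sum,
    MvPolynomial.coeff_sum, map_sum]
  symm
  refine Finset.sum_subset_zero_on_sdiff (Finset.range_subset_range.2 (by omega))
    (fun i hi => ?_) fun i hi => ?_
  · rw [Finset.mem_sdiff, Finset.mem_range, Finset.mem_range] at hi
    rw [hk i (by omega), Finset.sum_empty, MvPolynomial.coeff_zero]
  · rw [Finset.mem_range] at hi
    rw [map_sum, MvPolynomial.coeff_sum]
    refine Finset.sum_congr rfl fun v _ => ?_
    rw [map_zsmul, coeff_stanley v he (n := b + 1 + k - i) (by omega), MvPolynomial.coeff_smul]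

theorem mem_canonicalTerms_iff {w u : SInf}
    (hk : ∀ i, length w + length u < i → newTerms w u i = ∅) {t : Σ _ : ℕ, SInf} :
    t ∈ canonicalTerms w u ↔ t.2 ∈ newTerms w u t.1 := by
  rw [canonicalTerms, Finset.mem_sigma, Finset.mem_range, Nat.lt_succ_iff]
  refine and_iff_right_of_imp fun ht => ?_
  by_contra! hlt
  rw [hk _ hlt] at ht
  exact Finset.notMem_empty _ ht

theorem stanley_mul_eq_sum_canonicalTerms {w u : SInf}
    (hk : ∀ i, length w + length u < i → newTerms w u i = ∅) :
    stanley w * stanley u = ∑ t ∈ canonicalTerms w u, prodCoeff w u t.1 t.2 • stanley t.2 := by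
  rw [stanley_mul_eq_sum hk, canonicalTerms, Finset.sum_sigma]

section DirectSum

variable {p : ℕ} {w : Equiv.Perm (Fin p)} {u : SInf} {m : ℕ}

theorem prodCoeff_eq_runCount (hw : AscendsFrom m (ofFin w)) (hu : AscendsFrom m u)
    (hG : AscendsBelow m u) {n : ℕ} (hn : (rowsFrom 0 u).ncard ≤ n) :
    prodCoeff (ofFin w) u n = runCount (n + m) (ones n (directSum w u)) := by
  have h := (hasRoom_ones_directSum w hw hn).isSchubertExpansion_runCount
  rw [trunc_schubert_ones_directSum w hw hu hG] at h
  exact h.schubertExpansion_eq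

theorem le_ncard_rowsFrom_of_mem_newTerms (hw : AscendsFrom m (ofFin w)) (hu : AscendsFrom m u)
    (hG : AscendsBelow m u) {i : ℕ} {v : SInf} (hv : v ∈ newTerms (ofFin w) u i) :
    i ≤ (rowsFrom 0 u).ncard := by
  by_contra! hlt
  obtain ⟨n, rfl⟩ := Nat.exists_eq_add_of_lt hlt
  obtain ⟨hne, hrange⟩ := mem_newTerms_succ.1 hv
  rw [prodCoeff_eq_runCount hw hu hG hlt.le, runCount_apply, Nat.cast_ne_zero] at hne
  obtain ⟨l, hl, rfl⟩ := Set.nonempty_of_ncard_ne_zero hne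
  have hfix := (hasRoom_ones_directSum w hw hlt.le).fixesBelow_runEnd hl
  obtain ⟨v, hv⟩ := FixesBelow.exists_eq_ones (n := 1) fun i hi => hfix i (by omega)
  exact hrange ⟨v, hv.symm⟩

theorem newTerms_eq_empty (hw : AscendsFrom m (ofFin w)) (hu : AscendsFrom m u)
    (hG : AscendsBelow m u) {i : ℕ} (hi : length (ofFin w) + length u < i) :
    newTerms (ofFin w) u i = ∅ := by
  refine Finset.eq_empty_of_forall_notMem fun v hv => ?_
  have := le_ncard_rowsFrom_of_mem_newTerms hw hu hG hv
  have := ncard_rowsFrom_zero_le_length u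
  omega

theorem prodCoeff_eq_ncard_mtRunsTo (hw : AscendsFrom m (ofFin w)) (hu : AscendsFrom m u)
    (hG : AscendsBelow m u) (v : SInf) : prodCoeff (ofFin w) u m v =
      ((mtRunsTo (2 * m) (ones m (directSum w u)) (diagram v)).ncard : ℤ) := by
  rw [prodCoeff_eq_runCount hw hu hG hu.ncard_rowsFrom_zero_le, runCount_apply, ← two_mul,
    mtRunsTo_diagram]

end DirectSum

end SInf

theorem mainTheorem4_general {p : ℕ} (w : Equiv.Perm (Fin p)) (u : SInf) (m : ℕ)
    (hw : SInf.codeLength (SInf.ofFin w) ≤ m) (hu : ∀ i ∈ SInf.descents u, i + 1 = m) :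
    (SInf.stanley (SInf.ofFin w) * SInf.stanley u =
      ∑ t ∈ SInf.canonicalTerms (SInf.ofFin w) u,
        SInf.prodCoeff (SInf.ofFin w) u t.1 t.2 • SInf.stanley t.2) ∧
    (∀ t ∈ SInf.canonicalTerms (SInf.ofFin w) u, t.1 ≤ m ∧
      (SInf.mtRunsTo (2 * m) (SInf.ones m (SInf.directSum w u))
        (SInf.diagram (SInf.ones (m - t.1) t.2))).Finite ∧
      SInf.prodCoeff (SInf.ofFin w) u t.1 t.2 =
        ((SInf.mtRunsTo (2 * m) (SInf.ones m (SInf.directSum w u))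
          (SInf.diagram (SInf.ones (m - t.1) t.2))).ncard : ℤ)) ∧
    (∀ D : Set (ℕ × ℕ), (SInf.mtRunsTo (2 * m) (SInf.ones m (SInf.directSum w u)) D).Nonempty →
      ∃ t ∈ SInf.canonicalTerms (SInf.ofFin w) u,
        t.1 ≤ m ∧ D = SInf.diagram (SInf.ones (m - t.1) t.2)) := by
  have hwasc := SInf.codeLength_le_iff.1 hw
  have huasc : SInf.AscendsFrom m u := fun i hi =>
    (SInf.lt_or_gt_succ u i).resolve_right fun hdesc => by have := hu i hdesc; omega
  have hG : SInf.AscendsBelow m u := fun i hi =>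
    (SInf.lt_or_gt_succ u i).resolve_right fun hdesc => hi.ne (hu i hdesc)
  have hk := fun i => SInf.newTerms_eq_empty hwasc huasc hG (i := i)
  have hcoeff := SInf.prodCoeff_eq_ncard_mtRunsTo hwasc huasc hG
  refine ⟨SInf.stanley_mul_eq_sum_canonicalTerms hk, fun t ht => ?_, ?_⟩
  · have htm : t.1 ≤ m :=
      (SInf.le_ncard_rowsFrom_of_mem_newTerms hwasc huasc hG
        ((SInf.mem_canonicalTerms_iff hk).1 ht)).trans huasc.ncard_rowsFrom_zero_le
    refine ⟨htm, SInf.finite_mtRunsTo _ _ _, ?_⟩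
    rw [← hcoeff, ← SInf.prodCoeff_add_ones _ _ t.1 (m - t.1), Nat.add_sub_cancel' htm]
  · rintro D ⟨l, y, hy, rfl⟩
    have hne : SInf.prodCoeff (SInf.ofFin w) u m y ≠ 0 := by
      rw [hcoeff, Nat.cast_ne_zero]
      exact Set.ncard_ne_zero_of_mem ⟨y, hy, rfl⟩ (SInf.finite_mtRunsTo _ _ _)
    obtain ⟨i, hi, v, hv, rfl⟩ := SInf.exists_mem_newTerms hne
    exact ⟨⟨i, v⟩, (SInf.mem_canonicalTerms_iff hk).2 hv, hi, rfl⟩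

theorem mainTheorem4 {p q : ℕ} (w : Equiv.Perm (Fin p)) (u : Equiv.Perm (Fin q)) (m : ℕ)
    (hw : SInf.codeLength (SInf.ofFin w) = m) (hu : SInf.codeLength (SInf.ofFin u) = m)
    (hG : SInf.IsGrassmannian (SInf.ofFin u)) :
    -- the canonical expansion of `F_w F_u`
    (SInf.stanley (SInf.ofFin w) * SInf.stanley (SInf.ofFin u) =
      ∑ t ∈ SInf.canonicalTerms (SInf.ofFin w) (SInf.ofFin u),
        SInf.prodCoeff (SInf.ofFin w) (SInf.ofFin u) t.1 t.2 • SInf.stanley t.2) ∧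
    -- each coefficient `c_{wu}^v`, `v ∈ V_i`, is the multiplicity of `D(1^{m-i} × v)`
    (∀ t ∈ SInf.canonicalTerms (SInf.ofFin w) (SInf.ofFin u), t.1 ≤ m ∧
      (SInf.mtRunsTo (2 * m) (SInf.ones m (SInf.directSum w (SInf.ofFin u)))
        (SInf.diagram (SInf.ones (m - t.1) t.2))).Finite ∧
      SInf.prodCoeff (SInf.ofFin w) (SInf.ofFin u) t.1 t.2 =
        ((SInf.mtRunsTo (2 * m) (SInf.ones m (SInf.directSum w (SInf.ofFin u)))
          (SInf.diagram (SInf.ones (m - t.1) t.2))).ncard : ℤ)) ∧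
    -- no other diagrams are obtained
    (∀ D : Set (ℕ × ℕ),
      (SInf.mtRunsTo (2 * m) (SInf.ones m (SInf.directSum w (SInf.ofFin u))) D).Nonempty →
      ∃ t ∈ SInf.canonicalTerms (SInf.ofFin w) (SInf.ofFin u),
        t.1 ≤ m ∧ D = SInf.diagram (SInf.ones (m - t.1) t.2)) :=
  mainTheorem4_general w (SInf.ofFin u) m hw.le fun _ hi => (hG.succ_eq_codeLength hi).trans hu
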